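/- **Setting.** Let $S\subset\mathbb R^d$ and $A\subset\mathbb R^k$ be Borel sets (componentwise order on $S$), let $\Theta$ be a compact metric space and $1<p<\infty$. Assume that every point of $S$ has arbitrarily small neighbourhoods in $S$ of the form $\{x\in S: l\le x\le u\}$ with $l,u\in S$ close to the point (automatic if $d=1$, if $S$ is open, a product of subsets of $\mathbb R$, or a sublattice of $\mathbb R^d$). For each time $t\in\mathbb N$ there are given: a reference probability measure $Q_t$ on $S$; transition probabilities $q_t(s,a,\theta)$ on $S$; a bounded cost $c_t:S\times A\times\Theta\to[0,\infty)$; and a risk transition mapping $\sigma_t(v,s,\mu,\theta)\in\mathbb R$ for $v\in L_p(S,Q_t)$, $s\in S$, $\mu$ a probability measure on $S$, $\theta\in\Theta$. There are also a bounded terminal cost $c_{\rm T}:S\times\Theta\to[0,\infty)$, nonempty compact sets of admissible actions $\Gamma(s,\theta)\subset A$, and a discount factor $\gamma:\Theta\to(0,\bar\gamma]$, $\bar\gamma<1$. The set $\Pi$ of policies consists of all $\pi=(\pi_t)_{t\ge0}$, $\pi_t:S\times\Theta\to A$, with $\pi_t(s,\theta)\in\Gamma(s,\theta)$ and $\pi_t(\cdot,\theta)$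 Borel measurable. **Hypotheses.** For all $t$: 1. *(Monotone.)* If $s\le s'$, then for all $a,\theta$: $q_t(\{y\ge x\}\mid s,a,\theta)\le q_t(\{y\ge x\}\mid s',a,\theta)$ for every $x\in\mathbb R^d$; $c_t(s,a,\theta)\le c_t(s',a,\theta)$; $c_{\rm T}(s,\theta)\le c_{\rm T}(s',\theta)$; and $\Gamma(s,\theta)\supseteq\Gamma(s',\theta)$. 2. *(Separately continuous.)* $q_t$ is setwise continuous and $c_t$ is continuous in $(s,a)$ for each fixed $\theta$ and in $(a,\theta)$ for each fixed $s$; $c_{\rm T}$ is continuous, and $\Gamma$ is upper and lower hemicontinuous, in $s$ for each fixed $\theta$ and in $\theta$ for each fixed $s$; $\gamma$ is continuous. (Upper hemicontinuous at $x$: each open set containing the value at $x$ contains the values at all points near $x$. Lower hemicontinuous at $x$: each open set meeting the value at $x$ meets the values at all points near $x$.) 3. *(Markov, coherent.)* For $a\in\Gamma(s,\theta)$ the map $v\mapsto\sigma_t(v,s,q_t(s,a,\theta),\theta)$ is a coherent risk measure on $L_p(S,Q_t)$ (monotone, convex, translation equivariant, positively homogeneous); and for $v\in L_p(S,Q_t)$,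 $\theta\in\Theta$ and measurable $g:S\to A$ with $g(s)\in\Gamma(s,\theta)$, the map $s\mapsto\sigma_t(v,s,q_t(s,g(s),\theta),\theta)$ is in $L_p(S,Q_t)$. 4. *(Continuous envelope.)* Let $\Phi_t(s,\mu,\theta)$ be the set of $\phi\in L_p(S,Q_t)^*$, $\phi\ge0$, $\langle 1,\phi\rangle=1$, with $\langle v,\phi\rangle\le\sigma_t(v,s,\mu,\theta)$ for all $v\in L_p(S,Q_t)$. Then $\Phi_t$, with values in the dual with its weak* topology, is jointly upper and lower hemicontinuous in (state, measure, parameter), where probability measures on $S$ carry the topology of weak convergence; this is needed only on the subspace of triples $(s,q_t(s,a,\theta),\theta)$ with $a\in\Gamma(s,\theta)$. **Objectives.** For a horizon $T$ and $\pi\in\Pi$ put $J_{T,T}(s,\theta;\pi)=c_{\rm T}(s,\theta)$ and, for $t<T$, with $a=\pi_t(s,\theta)$, $$J_{t,T}(s,\theta;\pi)=c_t(s,a,\theta)+\sigma_t\big(J_{t+1,T}(\cdot,\theta;\pi),s,q_t(s,a,\theta),\theta\big);$$ $J_T=J_{0,T}$. Let $J_\infty(s,\theta;\pi)$ be the limit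 as $N\to\infty$ of the nested risk, formed in the same way, of the costs $\gamma(\theta)^tc_t$, $0\le t<N$, with zero terminal cost. **Theorem.** (i) For every $T$ and $t\le T$ the objectives $J_{t,T}$ are well defined (for $t<T$ and $\pi\in\Pi$, $J_{t+1,T}(\cdot,\theta;\pi)\in L_p(S,Q_t)$), the minimum $\min_{\pi\in\Pi}J_{t,T}(s,\theta;\pi)$ is attained, and it is jointly continuous in $(s,\theta)$ on $S\times\Theta$; in particular this holds for $\min_\pi J_T$. For $t<T$ the set of optimal actions $\{\pi_t(s,\theta):\pi\in\arg\min_{\Pi}J_{t,T}(s,\theta;\cdot)\}$ is nonempty and compact and is an upper hemicontinuous correspondence of $(s,\theta)$. Moreover, for all continuous $h_t:A\to\mathbb R$ there is $\pi^*\in\Pi$ that minimizes $J_{t,T}(s,\theta;\cdot)$ for all $t\le T$, $s$, $\theta$ and such that, for $t<T$, $\pi^*_t(s,\theta)$ minimizes $h_t$ over the optimal actions and $(s,\theta)\mapsto h_t(\pi_t^*(s,\theta))$ is lower semicontinuous. (For $A\subset\mathbb R$ and $h_t(a)=a$: the least optimal policy is lower semicontinuous.) (ii) Suppose that $Q_t,q_t,c_t,\sigma_t$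 do not depend on $t$. Then for every $\pi\in\Pi$ all truncated nested risks are well defined and the limit $J_\infty$ exists; $\min_{\pi\in\Pi}J_\infty(s,\theta;\pi)$ is attained and is jointly continuous on $S\times\Theta$; the set of optimal actions $\{f(s,\theta): (f,f,\dots)\in\Pi \text{ minimizes } J_\infty(s,\theta;\cdot)\text{ over }\Pi\}$ is nonempty and compact and is an upper hemicontinuous correspondence of $(s,\theta)$; and for every continuous $h:A\to\mathbb R$ there is a stationary policy $(f,f,\dots)\in\Pi$ that minimizes $J_\infty(s,\theta;\cdot)$ over $\Pi$ for all $(s,\theta)$, such that $f(s,\theta)$ minimizes $h$ over the optimal actions and $(s,\theta)\mapsto h(f(s,\theta))$ is lower semicontinuous. -/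

import Mathlib

open Set Filter Topology MeasureTheory
open scoped ENNReal

noncomputable section

namespace RiskMDP

/-- Data of one decision period. The state space `S` and the action space `A` are subsets of
finite-dimensional real coordinate spaces (componentwise order, usual topology and Borel sets).
`Q` is the reference probability measure of the period, `q s a θ` the law of the next state,
`c` the cost, and `σ X s μ θ` the risk transition mapping, defined for `X` in `L_p(S, Q)`. -/
structure Stage {d k : ℕ} (S : Set (Fin d → ℝ)) (A : Set (Fin k → ℝ)) (Θ : Type*)
    (p : ℝ≥0∞) where
  Q : ProbabilityMeasure S
  q : S → A → Θ → ProbabilityMeasure S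
  c : S → A → Θ → ℝ
  σ : Lp ℝ p (Q : Measure S) → S → ProbabilityMeasure S → Θ → ℝ

/-- Data of a parametric risk-sensitive Markov decision process: one `Stage` for each time,
the terminal cost `cT` of the finite-horizon problems, the admissible actions `Γ s θ`
and the discount factor `γ θ` of the infinite-horizon problem. -/
structure Model {d k : ℕ} (S : Set (Fin d → ℝ)) (A : Set (Fin k → ℝ)) (Θ : Type*)
    (p : ℝ≥0∞) where
  stage : ℕ → Stage S A Θ p
  cT : S → Θ → ℝ
  Γ : S → Θ → Set A
  γ : Θ → ℝ

/-! ### Order -/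

/-- First stochastic order: `P(X ≥ x) ≤ P(X' ≥ x)` for all `x`, with the componentwise order. -/
def StochLE {d : ℕ} {S : Set (Fin d → ℝ)} (μ ν : ProbabilityMeasure S) : Prop :=
  ∀ x : Fin d → ℝ,
    (μ : Measure S) {y : S | x ≤ (y : Fin d → ℝ)} ≤ (ν : Measure S) {y : S | x ≤ (y : Fin d → ℝ)}

/-- Every point of `S` has arbitrarily small neighbourhoods in `S` that are order intervals
with end points in `S`. This holds for every subset of the line, every open set, every product
of subsets of the line and every sublattice of the coordinate space. -/
def OrderNeighbourhoods {d : ℕ} (S : Set (Fin d → ℝ)) : Prop :=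
  ∀ s : S, ∀ U ∈ 𝓝 s, ∃ l ∈ U, ∃ u ∈ U, Icc l u ∈ 𝓝 s

/-! ### Coherent risk measures and risk envelopes -/

/-- A real-valued coherent risk measure on `L_p(S, μ)`. -/
structure IsCoherent {X : Type*} [MeasurableSpace X] {p : ℝ≥0∞} {μ : Measure X}
    [IsFiniteMeasure μ] (ρ : Lp ℝ p μ → ℝ) : Prop where
  monotone : ∀ f g : Lp ℝ p μ, f ≤ g → ρ f ≤ ρ g
  convex : ∀ (f g : Lp ℝ p μ) (α : ℝ), 0 ≤ α → α ≤ 1 →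
    ρ (α • f + (1 - α) • g) ≤ α * ρ f + (1 - α) * ρ g
  translation : ∀ (f : Lp ℝ p μ) (α : ℝ), ρ (f + Lp.const p μ α) = ρ f + α
  homogeneous : ∀ (f : Lp ℝ p μ) (α : ℝ), 0 < α → ρ (α • f) = α * ρ f

section

variable {d k : ℕ} {S : Set (Fin d → ℝ)} {A : Set (Fin k → ℝ)} {Θ : Type*} {p : ℝ≥0∞}

/-- The risk envelope `Φ(s, μ, θ)`: the probability densities `φ` in the dual of `L_p(S, Q)`
(positive functionals with `⟨1, φ⟩ = 1`) such that `⟨f, φ⟩ ≤ σ(f, s, μ, θ)` for all `f`.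
It is a subset of the dual space with its weak* topology. -/
def Stage.envelope [Fact (1 ≤ p)] (m : Stage S A Θ p) (s : S) (μ : ProbabilityMeasure S) (θ : Θ) :
    Set (WeakDual ℝ (Lp ℝ p (m.Q : Measure S))) :=
  {φ | (∀ f, 0 ≤ f → 0 ≤ φ f) ∧ φ (Lp.const p (m.Q : Measure S) (1 : ℝ)) = 1 ∧
    ∀ f, φ f ≤ m.σ f s μ θ}

/-- The mappings of a period are risk transition mappings of a Markov coherent conditional
risk measure: coherent in the first argument at every feasible state-action pair, and for every
measurable feasible decision rule the resulting function of the state is in `L_p(S, Q)`. -/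
structure Stage.IsMarkovCoherent (m : Stage S A Θ p) (Γ : S → Θ → Set A) : Prop where
  coherent : ∀ s θ, ∀ a ∈ Γ s θ,
    IsCoherent (μ := (m.Q : Measure S)) fun f => m.σ f s (m.q s a θ) θ
  memLp : ∀ (θ : Θ) (f : Lp ℝ p (m.Q : Measure S)) (g : S → A), Measurable g →
    (∀ s, g s ∈ Γ s θ) → MemLp (fun s => m.σ f s (m.q s (g s) θ) θ) p (m.Q : Measure S)

/-- The risk envelope of a period is a jointly continuous correspondence of
(state, measure, parameter), where measures on `S` carry the topology of weak convergence.
Continuity is asked only along the triples at which the envelope is used, that is, on the subspace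
of the triples `(s, q(s, a, θ), θ)` with `a` admissible. -/
def Stage.EnvelopeContinuous [Fact (1 ≤ p)] [TopologicalSpace Θ] (m : Stage S A Θ p)
    (Γ : S → Θ → Set A) : Prop :=
  UpperHemicontinuousOn
      (fun x : S × ProbabilityMeasure S × Θ => m.envelope x.1 x.2.1 x.2.2)
      {x | ∃ a ∈ Γ x.1 x.2.2, x.2.1 = m.q x.1 a x.2.2} ∧
    LowerHemicontinuousOn
      (fun x : S × ProbabilityMeasure S × Θ => m.envelope x.1 x.2.1 x.2.2)
      {x | ∃ a ∈ Γ x.1 x.2.2, x.2.1 = m.q x.1 a x.2.2}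

/-! ### Assumptions on the decision process -/

/-- Setwise continuity of a family of probability measures. -/
def SetwiseContinuous {Y : Type*} [TopologicalSpace Y] (q : Y → ProbabilityMeasure S) : Prop :=
  ∀ f : S → ℝ, Measurable f → (∃ C, ∀ x, |f x| ≤ C) →
    Continuous fun y => ∫ x, f x ∂(q y : Measure S)

/-- Monotone decision processes. -/
structure Model.IsMonotone (M : Model S A Θ p) : Prop where
  kernel : ∀ t (s s' : S), s ≤ s' → ∀ a θ,
    StochLE ((M.stage t).q s a θ) ((M.stage t).q s' a θ)
  cost : ∀ t (s s' : S), s ≤ s' → ∀ a θ, (M.stage t).c s a θ ≤ (M.stage t).c s' a θ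
  terminal : ∀ s s' : S, s ≤ s' → ∀ θ, M.cT s θ ≤ M.cT s' θ
  action : ∀ s s' : S, s ≤ s' → ∀ θ, M.Γ s' θ ⊆ M.Γ s θ

/-- Separately continuous decision processes. -/
structure Model.IsSepContinuous [TopologicalSpace Θ] (M : Model S A Θ p) : Prop where
  kernel_state : ∀ t θ, SetwiseContinuous fun x : S × A => (M.stage t).q x.1 x.2 θ
  kernel_param : ∀ t s, SetwiseContinuous fun x : A × Θ => (M.stage t).q s x.1 x.2
  cost_state : ∀ t θ, Continuous fun x : S × A => (M.stage t).c x.1 x.2 θ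
  cost_param : ∀ t s, Continuous fun x : A × Θ => (M.stage t).c s x.1 x.2
  terminal_state : ∀ θ, Continuous fun s => M.cT s θ
  terminal_param : ∀ s, Continuous fun θ => M.cT s θ
  action_state : ∀ θ, UpperHemicontinuous (fun s => M.Γ s θ) ∧
    LowerHemicontinuous fun s => M.Γ s θ
  action_param : ∀ s, UpperHemicontinuous (fun θ => M.Γ s θ) ∧
    LowerHemicontinuous fun θ => M.Γ s θ
  discount : Continuous M.γ ∧ ∃ γbar < 1, ∀ θ, 0 < M.γ θ ∧ M.γ θ ≤ γbar

/-- Standing conventions: costs are nonnegative and bounded, and the sets of admissible actions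
are nonempty and compact. -/
structure Model.IsRegular (M : Model S A Θ p) : Prop where
  cost : ∀ t, ∃ C, ∀ s a θ, 0 ≤ (M.stage t).c s a θ ∧ (M.stage t).c s a θ ≤ C
  terminal : ∃ C, ∀ s θ, 0 ≤ M.cT s θ ∧ M.cT s θ ≤ C
  action_nonempty : ∀ s θ, (M.Γ s θ).Nonempty
  action_compact : ∀ s θ, IsCompact (M.Γ s θ)

/-! ### Policies and objectives -/

/-- The set `Π` of feasible policies. -/
def Model.policies (M : Model S A Θ p) : Set (ℕ → S → Θ → A) :=
  {π | (∀ t θ, Measurable fun s => π t s θ) ∧ ∀ t s θ, π t s θ ∈ M.Γ s θ}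

/-- The stationary policy that uses the decision rule `f` at all times. -/
def stationary (f : S → Θ → A) : ℕ → S → Θ → A := fun _ => f

open Classical in
/-- The class in `L_p` of a function (zero when the function is not in `L_p`). -/
def toLpClass {X : Type*} [MeasurableSpace X] (p : ℝ≥0∞) (μ : Measure X) (f : X → ℝ) : Lp ℝ p μ :=
  if h : MemLp f p μ then h.toLp f else 0

/-- Nested risk of `n` periods, started at time `t`: the cost of time `t`, weighted by `w t θ`,
plus the one-step conditional risk of the nested risk of the remaining `n - 1` periods, and finally
the terminal cost `term`. By the Markov property the one-step conditional risk, given the state `s`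
and the action `a`, of a function `f` of the next state is `σ(f, s, q(s, a, θ), θ)`. -/
def Model.nested (M : Model S A Θ p) (w : ℕ → Θ → ℝ) (term : S → Θ → ℝ)
    (π : ℕ → S → Θ → A) : ℕ → ℕ → S → Θ → ℝ
  | 0, _ => term
  | n + 1, t => fun s θ =>
      w t θ * (M.stage t).c s (π t s θ) θ +
        (M.stage t).σ
          (toLpClass p ((M.stage t).Q : Measure S) fun s' => M.nested w term π n (t + 1) s' θ)
          s ((M.stage t).q s (π t s θ) θ) θ

/-- Risk-sensitive cost of the times `t, …, T` of the problem with horizon `T`, started at time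
`t ≤ T` in the state `s`. For `t = 0` this is the objective `J_T(s, θ; π)`. -/
def Model.finiteCost (M : Model S A Θ p) (T t : ℕ) (s : S) (θ : Θ) (π : ℕ → S → Θ → A) : ℝ :=
  M.nested (fun _ _ => 1) M.cT π (T - t) t s θ

/-- Nested risk of the discounted costs of the times `0, …, N - 1`. -/
def Model.truncatedCost (M : Model S A Θ p) (N : ℕ) (s : S) (θ : Θ) (π : ℕ → S → Θ → A) : ℝ :=
  M.nested (fun t θ => M.γ θ ^ t) (fun _ _ => 0) π N 0 s θ

/-- The infinite-horizon objective `J_∞(s, θ; π)`, the limit of the truncated objectives. -/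
def Model.infiniteCost (M : Model S A Θ p) (s : S) (θ : Θ) (π : ℕ → S → Θ → A) : ℝ :=
  limUnder atTop fun N => M.truncatedCost N s θ π

/-- Value function at time `t` of the problem with horizon `T`. -/
def Model.finiteValue (M : Model S A Θ p) (T t : ℕ) (s : S) (θ : Θ) : ℝ :=
  sInf (M.finiteCost T t s θ '' M.policies)

/-- Value function of the infinite-horizon problem. -/
def Model.infiniteValue (M : Model S A Θ p) (s : S) (θ : Θ) : ℝ :=
  sInf (M.infiniteCost s θ '' M.policies)

/-- Optimal actions at time `t` and `(s, θ)`: the values there of the policies that minimize the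
cost from time `t` on, started in `s`. -/
def Model.finiteOptimalActions (M : Model S A Θ p) (T t : ℕ) (s : S) (θ : Θ) : Set A :=
  {a | ∃ π ∈ M.policies, π t s θ = a ∧ IsMinOn (M.finiteCost T t s θ) M.policies π}

/-- Optimal actions at `(s, θ)` of the infinite-horizon problem: the values there of the stationary
policies that minimize the objective (over all policies) from the initial state `s`. -/
def Model.infiniteOptimalActions (M : Model S A Θ p) (s : S) (θ : Θ) : Set A :=
  {a | ∃ f : S → Θ → A, stationary f ∈ M.policies ∧ f s θ = a ∧
    IsMinOn (M.infiniteCost s θ) M.policies (stationary f)}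

end

end RiskMDP

end

/-! The proof is dynamic programming with Berge's maximum theorem; the work lies in obtaining joint
continuity from data that are only separately continuous in state and parameter. Monotonicity
provides it: near a state everything is squeezed between the values at the end points of a small
order interval, and these end points stay fixed while action and parameter move. For the kernels
this applies to the probabilities of upper orthants; half-open boxes are differences of unions of
orthants, and convergence on boxes gives weak convergence, the topology in which the envelopes are
continuous.

A real-valued coherent risk measure on `L_p` is automatically bounded, so Hahn–Banach yields, for
each position, a density in the envelope that attains the risk. Hemicontinuity of the envelope
therefore makes the risk of a fixed position continuous, and Banach–Steinhaus extends this to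
positions that converge in `L_p`; as `p` is finite, bounded pointwise convergence suffices.

The Bellman function is then continuous on the graph of `Γ`. Berge's theorem keeps the value
functions bounded and continuous and makes the greedy actions a compact-valued upper hemicontinuous
correspondence. The optimal actions are exactly the greedy ones, and optimal policies are measurable
selections of them. In the stationary discounted problem, positive homogeneity turns a shift in time
into a factor `γ θ`. The Bellman operator, nonexpansive by monotonicity and translation
equivariance, thereby becomes a contraction. -/

namespace RiskMDP

/-- The set of minimizers of `h` over `K`. -/
def argminOn {A : Type*} (h : A → ℝ) (K : Set A) : Set A := {a ∈ K | IsMinOn h K a}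

theorem argminOn_subset {A : Type*} {h : A → ℝ} {K : Set A} : argminOn h K ⊆ K := fun _ ha => ha.1

theorem le_of_mem_argminOn {A : Type*} {h : A → ℝ} {K : Set A} {a b : A} (ha : a ∈ argminOn h K)
    (hb : b ∈ K) : h a ≤ h b := isMinOn_iff.1 ha.2 b hb

theorem sInf_image_eq_of_mem_argminOn {A : Type*} {h : A → ℝ} {K : Set A} {a : A} (ha : a ∈ argminOn h K) :
    sInf (h '' K) = h a :=
  IsLeast.csInf_eq ⟨mem_image_of_mem h ha.1, by rintro _ ⟨b, hb, rfl⟩; exact ha.2 hb⟩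

/-! ### Berge's maximum theorem -/

section Correspondences

variable {X A : Type*} [TopologicalSpace X] [TopologicalSpace A]

/-- Tube lemma for compact-valued upper hemicontinuous correspondences: a property that holds near
every point of the graph over `x₀` holds on the whole graph over a neighbourhood of `x₀`. -/
theorem eventually_forall_mem_of_upperHemicontinuousAt {Γ : X → Set A} {x₀ : X}
    (hΓ : UpperHemicontinuousAt Γ x₀) (hc : IsCompact (Γ x₀)) {P : X → A → Prop}
    (hP : ∀ a ∈ Γ x₀, ∀ᶠ y in 𝓝 (x₀, a), y.2 ∈ Γ y.1 → P y.1 y.2) :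
    ∀ᶠ x in 𝓝 x₀, ∀ a ∈ Γ x, P x a := by
  have h1 : ∀ᶠ y in 𝓝 x₀ ×ˢ 𝓝ˢ (Γ x₀), y.2 ∈ Γ y.1 → P y.1 y.2 := by
    -- Both factors are compact, so the neighbourhoods of `{x₀} ×ˢ Γ x₀` are generated by products.
    rw [← nhdsSet_singleton, ← isCompact_singleton.nhdsSet_prod_eq hc, nhdsSet,
      Filter.eventually_sSup]
    rintro _ ⟨⟨x, a⟩, ⟨hx, ha⟩, rfl⟩
    obtain rfl : x = x₀ := hx
    exact hP a ha
  obtain ⟨p, hp, q, hq, h⟩ := Filter.eventually_prod_iff.1 h1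
  filter_upwards [hp, hΓ _ hq] with x hx hqx a ha
  exact h hx (subset_of_mem_nhdsSet hqx ha) ha

theorem nonempty_argminOn {h : A → ℝ} {K : Set A} (hK : IsCompact K) (hne : K.Nonempty)
    (hh : ContinuousOn h K) : (argminOn h K).Nonempty := by
  obtain ⟨a, ha, hmin⟩ := hK.exists_isMinOn hne hh
  exact ⟨a, ha, hmin⟩

theorem sInf_image_le_of_isCompact {h : A → ℝ} {K : Set A} (hK : IsCompact K)
    (hh : ContinuousOn h K) {a : A} (ha : a ∈ K) : sInf (h '' K) ≤ h a :=
  csInf_le (hK.bddBelow_image hh) (mem_image_of_mem h ha)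

theorem mem_argminOn_of_le {h : A → ℝ} {K : Set A} (hK : IsCompact K)
    (hh : ContinuousOn h K) {a : A} (ha : a ∈ K) (hle : h a ≤ sInf (h '' K)) :
    a ∈ argminOn h K :=
  ⟨ha, fun _ hb => hle.trans (sInf_image_le_of_isCompact hK hh hb)⟩

theorem isCompact_argminOn [T2Space A] {h : A → ℝ} {K : Set A} (hK : IsCompact K)
    (hh : ContinuousOn h K) : IsCompact (argminOn h K) := by
  rcases (argminOn h K).eq_empty_or_nonempty with h0 | ⟨a, ha⟩
  · simp [h0]
  have : argminOn h K = K ∩ h ⁻¹' Iic (h a) := by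
    ext b
    exact ⟨fun hb => ⟨hb.1, le_of_mem_argminOn hb ha.1⟩,
      fun hb => ⟨hb.1, fun c hc => le_trans (mem_Iic.1 hb.2) (le_of_mem_argminOn ha hc)⟩⟩
  rw [this]
  exact hK.of_isClosed_subset (hh.preimage_isClosed_of_isClosed hK.isClosed isClosed_Iic)
    inter_subset_left

/-- Berge: lower semicontinuity of the minimum over an upper hemicontinuous correspondence. -/
theorem lowerSemicontinuous_sInf_image {Γ : X → Set A} {F : X → A → ℝ}
    (hΓ : UpperHemicontinuous Γ) (hc : ∀ x, IsCompact (Γ x)) (hne : ∀ x, (Γ x).Nonempty)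
    (hF : ContinuousOn (fun y : X × A => F y.1 y.2) {y | y.2 ∈ Γ y.1}) :
    LowerSemicontinuous fun x => sInf (F x '' Γ x) := by
  have hFx : ∀ x, ContinuousOn (F x) (Γ x) := fun x =>
    hF.comp (f := fun a => (x, a)) (by fun_prop) fun a ha => ha
  intro x r hr
  have := eventually_forall_mem_of_upperHemicontinuousAt (hΓ x) (hc x)
    (P := fun x a => r < F x a) fun a ha => by
      have h1 := hF (x, a) ha
      have h2 : r < F x a := lt_of_lt_of_le hr (sInf_image_le_of_isCompact (hc x) (hFx x) ha)
      exact eventually_nhdsWithin_iff.1 (h1.eventually_const_lt h2)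
  filter_upwards [this] with y hy
  obtain ⟨a, ha⟩ := nonempty_argminOn (hc y) (hne y) (hFx y)
  rw [sInf_image_eq_of_mem_argminOn ha]
  exact hy a ha.1

/-- Berge's maximum theorem: continuity of the minimum. -/
theorem continuous_sInf_image {Γ : X → Set A} {F : X → A → ℝ}
    (hΓ : UpperHemicontinuous Γ) (hΓ' : LowerHemicontinuous Γ)
    (hc : ∀ x, IsCompact (Γ x)) (hne : ∀ x, (Γ x).Nonempty)
    (hF : ContinuousOn (fun y : X × A => F y.1 y.2) {y | y.2 ∈ Γ y.1}) :
    Continuous fun x => sInf (F x '' Γ x) := by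
  have hFx : ∀ x, ContinuousOn (F x) (Γ x) := fun x =>
    hF.comp (f := fun a => (x, a)) (by fun_prop) fun a ha => ha
  refine continuous_iff_lower_upperSemicontinuous.2
    ⟨lowerSemicontinuous_sInf_image hΓ hc hne hF, fun x r hr => ?_⟩
  obtain ⟨a, ha⟩ := nonempty_argminOn (hc x) (hne x) (hFx x)
  have h1 := hF (x, a) ha.1
  have h2 : F x a < r := by
    have := sInf_image_eq_of_mem_argminOn ha
    exact this ▸ hr
  have h3 := eventually_nhdsWithin_iff.1 (h1.eventually_lt_const h2)
  rw [nhds_prod_eq, Filter.eventually_prod_iff] at h3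
  obtain ⟨p, hp, q, hq, h⟩ := h3
  obtain ⟨O, hO, hOo, haO⟩ := mem_nhds_iff.1 hq
  filter_upwards [hp, hΓ' x O ⟨hOo, ⟨a, ha.1, haO⟩⟩] with y hy ⟨_, b, hb, hbO⟩
  exact lt_of_le_of_lt (sInf_image_le_of_isCompact (hc y) (hFx y) hb) (h hy (hO hbO) hb)

/-- Berge's maximum theorem: upper hemicontinuity of the minimizers. -/
theorem upperHemicontinuous_argminOn {Γ : X → Set A} {F : X → A → ℝ}
    (hΓ : UpperHemicontinuous Γ) (hΓ' : LowerHemicontinuous Γ)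
    (hc : ∀ x, IsCompact (Γ x)) (hne : ∀ x, (Γ x).Nonempty)
    (hF : ContinuousOn (fun y : X × A => F y.1 y.2) {y | y.2 ∈ Γ y.1}) :
    UpperHemicontinuous fun x => argminOn (F x) (Γ x) := by
  have hFx : ∀ x, ContinuousOn (F x) (Γ x) := fun x =>
    hF.comp (f := fun a => (x, a)) (by fun_prop) fun a ha => ha
  have hV := continuous_sInf_image hΓ hΓ' hc hne hF
  refine UpperHemicontinuous.of_forall_isOpen fun x U hU hsub => ?_
  -- A feasible action outside `U` costs strictly more than the minimum, and this persists nearby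
  -- because the minimum is continuous. Hence minimizers at nearby points lie in `U`.
  have := eventually_forall_mem_of_upperHemicontinuousAt (hΓ x) (hc x)
    (P := fun y a => F y a ≤ sInf (F y '' Γ y) → a ∈ U) fun a ha => by
      by_cases haU : a ∈ U
      · filter_upwards [(hU.preimage continuous_snd).mem_nhds haU] with y hy _ _
        exact hy
      · have h2 : sInf (F x '' Γ x) < F x a :=
          lt_of_not_ge fun hle => haU (hsub (mem_argminOn_of_le (hc x) (hFx x) ha hle))
        have h1 := hF (x, a) ha
        have h3 : ContinuousWithinAt (fun y : X × A => sInf (F y.1 '' Γ y.1))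
            {y | y.2 ∈ Γ y.1} (x, a) := (hV.comp continuous_fst).continuousWithinAt
        filter_upwards [eventually_nhdsWithin_iff.1 (h3.eventually_lt h1 h2)] with y hy hyΓ hle
        exact absurd hle (not_le.2 (hy hyΓ))
  filter_upwards [this] with y hy a ha
  exact hy a ha.1 (sInf_image_eq_of_mem_argminOn ha).ge

end Correspondences

/-! ### Measurable selection by lexicographic minimization -/

section Selection

variable {X A : Type*} [MeasurableSpace X] [TopologicalSpace A]

/-- Correspondences with nonempty compact values that are measurable in the sense that the states
whose value meets a given closed set form a measurable set. -/
structure IsMeasurableCompact (G : X → Set A) : Prop where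
  nonempty : ∀ x, (G x).Nonempty
  compact : ∀ x, IsCompact (G x)
  hit : ∀ C, IsClosed C → MeasurableSet {x | (G x ∩ C).Nonempty}

theorem isMeasurableCompact_of_upperHemicontinuous [TopologicalSpace X] [OpensMeasurableSpace X]
    {G : X → Set A} (hne : ∀ x, (G x).Nonempty) (hc : ∀ x, IsCompact (G x))
    (hG : UpperHemicontinuous G) : IsMeasurableCompact G := by
  refine ⟨hne, hc, fun C hC => ?_⟩
  have : {x | (G x ∩ C).Nonempty} = (G ⁻¹' Iic Cᶜ)ᶜ := by
    ext x
    simp [Set.subset_compl_iff_disjoint_right, Set.not_disjoint_iff_nonempty_inter]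
  rw [this]
  exact (upperHemicontinuous_iff_isClosed_compl_preimage_Iic_compl.1 hG C hC).measurableSet

/-- The minimum of `h` over `G x` is attained in `C` exactly when every rational level reached on `G
x` is also reached on `G x ∩ C`. This is a countable condition on sets of states that hit closed
sets. -/
theorem IsMeasurableCompact.argminOn [T2Space A] {G : X → Set A} (hG : IsMeasurableCompact G)
    {h : A → ℝ} (hh : Continuous h) : IsMeasurableCompact fun x => argminOn h (G x) := by
  refine ⟨fun x => nonempty_argminOn (hG.compact x) (hG.nonempty x) hh.continuousOn,
    fun x => isCompact_argminOn (hG.compact x) hh.continuousOn, fun C hC => ?_⟩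
  have hle : ∀ r : ℚ, IsClosed {a | h a ≤ r} := fun r => isClosed_le hh continuous_const
  have : {x | (RiskMDP.argminOn h (G x) ∩ C).Nonempty} =
      ⋂ r : ℚ, ({x | (G x ∩ {a | h a ≤ r}).Nonempty}ᶜ ∪
        {x | (G x ∩ (C ∩ {a | h a ≤ r})).Nonempty}) := by
    ext x
    simp only [mem_iInter, mem_union, mem_compl_iff, mem_ofPred_eq, ← imp_iff_not_or]
    constructor
    · rintro ⟨a, ha, haC⟩ r ⟨b, hb, hbr⟩
      exact ⟨a, ha.1, haC, le_trans (le_of_mem_argminOn ha hb) (show h b ≤ r from hbr)⟩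
    · intro H
      obtain ⟨a, ha⟩ := nonempty_argminOn (hG.compact x) (hG.nonempty x) hh.continuousOn
      obtain ⟨r, hr⟩ := exists_rat_gt (h a)
      obtain ⟨b, hb, hbC, -⟩ := H r ⟨a, ha.1, hr.le⟩
      -- `c` minimizes `h` over `G x ∩ C`. If it were not a global minimizer, a rational between the
      -- two minima would be a level reached on `G x` but not in `C`.
      obtain ⟨c, hc, hcmin⟩ := ((hG.compact x).inter_right hC).exists_isMinOn ⟨b, hb, hbC⟩
        hh.continuousOn
      refine ⟨c, ⟨hc.1, fun d hd => ?_⟩, hc.2⟩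
      change h c ≤ h d
      refine le_trans ?_ (le_of_mem_argminOn ha hd)
      by_contra! hlt
      obtain ⟨r, hr1, hr2⟩ := exists_rat_btwn hlt
      obtain ⟨e, he, heC, her⟩ := H r ⟨a, ha.1, hr1.le⟩
      have h1 : h c ≤ h e := hcmin ⟨he, heC⟩
      have h2 : h e ≤ r := her
      linarith
  rw [this]
  exact MeasurableSet.iInter fun r => ((hG.hit _ (hle r)).compl).union (hG.hit _ (hC.inter (hle r)))

/-- Each function is constant on its own set of minimizers and stays so under later restrictions.
With functions that separate points, a single point remains. -/
theorem IsMeasurableCompact.exists_subset_forall_eq [T2Space A] {G : X → Set A}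
    (hG : IsMeasurableCompact G) (L : List (A → ℝ)) (hL : ∀ h ∈ L, Continuous h) :
    ∃ G' : X → Set A, IsMeasurableCompact G' ∧ (∀ x, G' x ⊆ G x) ∧
      ∀ h ∈ L, ∀ x, ∀ a ∈ G' x, ∀ b ∈ G' x, h a = h b := by
  induction L generalizing G with
  | nil => exact ⟨G, hG, fun _ => Subset.rfl, by simp⟩
  | cons h L ih =>
    obtain ⟨G', h1, h2, h3⟩ := ih (hG.argminOn (hL h (by simp))) fun g hg => hL g (by simp [hg])
    refine ⟨G', h1, fun x => (h2 x).trans argminOn_subset, fun g hg x a ha b hb => ?_⟩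
    rcases List.mem_cons.1 hg with rfl | hg
    · exact le_antisymm ((h2 x ha).2 (h2 x hb).1) ((h2 x hb).2 (h2 x ha).1)
    · exact h3 g hg x a ha b hb

/-- Measurable selection from a measurable compact-valued correspondence whose points are separated
by finitely many continuous functions. -/
theorem IsMeasurableCompact.exists_measurable_selection [T2Space A] [MeasurableSpace A]
    [BorelSpace A] {G : X → Set A} (hG : IsMeasurableCompact G) {k : ℕ} (e : Fin k → A → ℝ)
    (he : ∀ i, Continuous (e i)) (hsep : ∀ a b, (∀ i, e i a = e i b) → a = b) :
    ∃ f : X → A, Measurable f ∧ ∀ x, f x ∈ G x := by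
  obtain ⟨G', h1, h2, h3⟩ := hG.exists_subset_forall_eq (List.ofFn e) (by simp [he])
  choose f hf using h1.nonempty
  refine ⟨f, measurable_of_isClosed fun C hC => ?_, fun x => h2 x (hf x)⟩
  -- `G' x` is the single point `f x`, so `f x ∈ C` means that `G' x` meets `C`.
  convert h1.hit C hC using 1
  ext x
  refine ⟨fun hx => ⟨f x, hf x, hx⟩, ?_⟩
  rintro ⟨a, ha, haC⟩
  have : f x = a := hsep _ _ fun i => h3 (e i) (by simp) x _ (hf x) _ ha
  simpa [this] using haC

end Selection

end RiskMDP

namespace RiskMDP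

/-! ### Coherent risk measures: boundedness, duality, continuous convergence -/

section Coherent

variable {X : Type*} [MeasurableSpace X] {p : ℝ≥0∞} {μ : Measure X} [IsFiniteMeasure μ]
  {ρ : Lp ℝ p μ → ℝ}

theorem IsCoherent.map_zero (h : IsCoherent ρ) : ρ 0 = 0 := by
  have := h.homogeneous 0 2 (by norm_num)
  rw [smul_zero] at this
  linarith

theorem IsCoherent.map_add_le (h : IsCoherent ρ) (f g : Lp ℝ p μ) : ρ (f + g) ≤ ρ f + ρ g := by
  have h1 := h.convex ((2 : ℝ) • f) ((2 : ℝ) • g) (1 / 2) (by norm_num) (by norm_num)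
  rw [smul_smul, smul_smul, h.homogeneous f 2 (by norm_num), h.homogeneous g 2 (by norm_num)] at h1
  norm_num at h1
  linarith

theorem IsCoherent.map_const (h : IsCoherent ρ) (α : ℝ) : ρ (Lp.const p μ α) = α := by
  have := h.translation 0 α
  rwa [zero_add, h.map_zero, zero_add] at this

/-- A coherent risk measure on `L_p` is bounded. -/
theorem IsCoherent.exists_bound [Fact (1 ≤ p)] (h : IsCoherent ρ) :
    ∃ K : ℝ, ∀ f, ρ f ≤ K * ‖f‖ := by
  -- Otherwise there are `f n` with `ρ (f n) > 4 ^ n * ‖f n‖`. Scaled to norm `2⁻ⁿ`, they have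
  -- summable absolute values; the sum dominates each scaled position, so its risk is at least `2 ^
  -- n` for every `n`.
  by_contra! hK
  choose f hf using fun n : ℕ => hK (4 ^ n)
  have hpos : ∀ n, 0 < ‖f n‖ := fun n => by
    rw [norm_pos_iff]
    intro h0
    have := hf n
    simp [h0, h.map_zero] at this
  set g : ℕ → Lp ℝ p μ := fun n => |((1 / 2) ^ n * ‖f n‖⁻¹ : ℝ) • f n| with hg
  have hnorm : ∀ n, ‖g n‖ = (1 / 2) ^ n := fun n => by
    rw [hg, norm_abs_eq_norm, norm_smul, norm_mul, norm_inv, norm_norm, mul_assoc,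
      inv_mul_cancel₀ (hpos n).ne']
    simp
  have hsum : Summable g := Summable.of_norm (by simpa only [hnorm] using summable_geometric_two)
  have hle : ∀ n, (2 : ℝ) ^ n ≤ ρ (∑' n, g n) := fun n => by
    have h1 : g n ≤ ∑' n, g n := hsum.le_tsum n fun j _ => abs_nonneg _
    refine le_trans ?_ (h.monotone _ _ ((le_abs_self _).trans h1))
    have hc : 0 < ((1 / 2) ^ n * ‖f n‖⁻¹ : ℝ) := mul_pos (by positivity) (inv_pos.2 (hpos n))
    rw [h.homogeneous _ _ hc]
    calc (2 : ℝ) ^ n = (1 / 2) ^ n * ‖f n‖⁻¹ * (4 ^ n * ‖f n‖) := by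
          have : (4 : ℝ) ^ n = 2 ^ n * 2 ^ n := by rw [← mul_pow]; norm_num
          have := (hpos n).ne'
          rw [‹(4 : ℝ) ^ n = _›, one_div, inv_pow]
          field_simp
      _ ≤ _ := mul_le_mul_of_nonneg_left (hf n).le hc.le
  obtain ⟨n, hn⟩ := pow_unbounded_of_one_lt (ρ (∑' n, g n)) (one_lt_two)
  exact absurd (hle n) (not_le.2 hn)

/-- Dual representation: a coherent risk measure is at every point attained by a density below
it. -/
theorem IsCoherent.exists_dual_eq [Fact (1 ≤ p)] (h : IsCoherent ρ) (v : Lp ℝ p μ) :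
    ∃ φ : Lp ℝ p μ →L[ℝ] ℝ, (∀ f, 0 ≤ f → 0 ≤ φ f) ∧ φ (Lp.const p μ (1 : ℝ)) = 1 ∧
      (∀ f, φ f ≤ ρ f) ∧ φ v = ρ v := by
  have hneg : ∀ f, -ρ (-f) ≤ ρ f := fun f => by
    have := h.map_add_le f (-f)
    rw [add_neg_cancel, h.map_zero] at this
    linarith
  -- On the span of `v` the functional `c • v ↦ c * ρ v` lies below `ρ`; for negative `c` this is
  -- `-ρ (-v) ≤ ρ v`. It is well defined only for `v ≠ 0`, hence the case distinction.
  have hdom : ∃ F : Lp ℝ p μ →ₗ.[ℝ] ℝ, (∀ x : F.domain, F x ≤ ρ x) ∧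
      ∃ hv : v ∈ F.domain, F ⟨v, hv⟩ = ρ v := by
    by_cases hv : v = 0
    · refine ⟨⟨⊥, 0⟩, ?_, ?_⟩
      · rintro ⟨x, hx⟩
        obtain rfl := (Submodule.mem_bot ℝ).1 hx
        simp [h.map_zero]
      · subst hv
        exact ⟨Submodule.zero_mem _, by simp [h.map_zero]⟩
    · refine ⟨LinearPMap.mkSpanSingleton v (ρ v) hv, ?_, ?_⟩
      · rintro ⟨x, hx⟩
        obtain ⟨c, rfl⟩ := Submodule.mem_span_singleton.1 hx
        rw [LinearPMap.mkSpanSingleton'_apply]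
        rcases lt_trichotomy c 0 with hc | rfl | hc
        · have := h.homogeneous (-v) (-c) (by linarith)
          rw [smul_neg, neg_smul, neg_neg] at this
          simp only [smul_eq_mul, this, RingHom.id_apply]
          nlinarith [hneg v]
        · simp [h.map_zero]
        · simp [h.homogeneous v c hc]
      · exact ⟨Submodule.mem_span_singleton_self v, by
          simpa using LinearPMap.mkSpanSingleton_apply ℝ ℝ hv (ρ v)⟩
  obtain ⟨F, hF, hv, hFv⟩ := hdom
  obtain ⟨g, hg1, hg2⟩ := exists_extension_of_le_sublinear F ρ
    (fun c hc x => h.homogeneous x c hc) h.map_add_le hF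
  obtain ⟨K, hK⟩ := h.exists_bound
  have hbd : ∀ f, ‖g f‖ ≤ K * ‖f‖ := fun f => by
    rw [Real.norm_eq_abs, abs_le]
    have h1 := (hg2 (-f)).trans (hK (-f))
    rw [norm_neg, _root_.map_neg] at h1
    exact ⟨by linarith, (hg2 f).trans (hK f)⟩
  refine ⟨g.mkContinuous K hbd, fun f hf => ?_, ?_, hg2, ?_⟩
  · have h1 := (hg2 (-f)).trans (h.monotone (-f) 0 (neg_nonpos.2 hf))
    rw [_root_.map_neg, h.map_zero] at h1
    change 0 ≤ g f
    linarith
  -- Domination at the constants `1` and `-1` bounds the value at `1` from both sides.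
  · have h1 := hg2 (Lp.const p μ 1)
    have h2 := hg2 (Lp.const p μ (-1))
    rw [h.map_const] at h1 h2
    rw [_root_.map_neg, _root_.map_neg] at h2
    change g _ = 1
    linarith
  · change g v = ρ v
    rw [← hFv]
    exact hg1 ⟨v, hv⟩

/-- Pointwise convergence of coherent risk measures implies continuous convergence. -/
theorem tendsto_of_forall_isCoherent [Fact (1 ≤ p)] {ρ : ℕ → Lp ℝ p μ → ℝ} {ρ' : Lp ℝ p μ → ℝ}
    (h : ∀ n, IsCoherent (ρ n)) (hρ : ∀ v, Tendsto (fun n => ρ n v) atTop (𝓝 (ρ' v)))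
    {v : ℕ → Lp ℝ p μ} {w : Lp ℝ p μ} (hv : Tendsto v atTop (𝓝 w)) :
    Tendsto (fun n => ρ n (v n)) atTop (𝓝 (ρ' w)) := by
  -- The functionals below some `ρ n` are bounded at each `f`: above by the convergent sequence `ρ n
  -- f`, below by `-ρ n (-f)`. The common norm bound `K` makes all `ρ n` Lipschitz with one
  -- constant, through their supporting functionals.
  obtain ⟨K, hK⟩ := banach_steinhaus
    (g := fun i : {i : ℕ × (Lp ℝ p μ →L[ℝ] ℝ) // ∀ f, i.2 f ≤ ρ i.1 f} => i.1.2) fun f => by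
      obtain ⟨a, ha⟩ := (hρ f).bddAbove_range
      obtain ⟨b, hb⟩ := (hρ (-f)).bddAbove_range
      refine ⟨max a b, fun i => ?_⟩
      have h1 := i.2 (-f)
      rw [_root_.map_neg] at h1
      exact abs_le.2 ⟨by linarith [hb ⟨i.1.1, rfl⟩, le_max_right a b],
        ((i.2 f).trans (ha ⟨i.1.1, rfl⟩)).trans (le_max_left a b)⟩
  have key : ∀ n (f g : Lp ℝ p μ), ρ n f - ρ n g ≤ K * ‖f - g‖ := fun n f g => by
    obtain ⟨φ, -, -, h3, h4⟩ := (h n).exists_dual_eq f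
    have h5 := h3 g
    have h6 := (le_abs_self _).trans
      (φ.le_of_opNorm_le (hK ⟨(n, φ), h3⟩) (f - g))
    rw [map_sub] at h6
    linarith
  have hdiff : Tendsto (fun n => ρ n (v n) - ρ n w) atTop (𝓝 0) := by
    have h0 : Tendsto (fun n => K * ‖v n - w‖) atTop (𝓝 0) := by
      simpa using (tendsto_iff_norm_sub_tendsto_zero.1 hv).const_mul K
    refine squeeze_zero_norm (fun n => abs_le.2 ⟨?_, key n _ _⟩) h0
    have := key n w (v n)
    rw [norm_sub_rev] at this
    linarith
  simpa using hdiff.add (hρ w)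

end Coherent

/-! ### Bounded functions as elements of `L_p` -/

section LpClass

variable {X : Type*} [MeasurableSpace X] {p : ℝ≥0∞} {μ : Measure X}

/-- Bounded measurable functions. -/
def IsBoundedMeasurable (f : X → ℝ) : Prop := Measurable f ∧ ∃ C, ∀ x, |f x| ≤ C

theorem IsBoundedMeasurable.memLp {f : X → ℝ} (hf : IsBoundedMeasurable f) (p : ℝ≥0∞)
    (μ : Measure X) [IsFiniteMeasure μ] : MemLp f p μ := by
  obtain ⟨hm, C, hC⟩ := hf
  exact MemLp.of_bound hm.aestronglyMeasurable C (ae_of_all _ hC)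

theorem toLpClass_eq {f : X → ℝ} (hf : MemLp f p μ) : toLpClass p μ f = hf.toLp f := dif_pos hf

theorem toLpClass_mono {f g : X → ℝ} (hf : MemLp f p μ) (hg : MemLp g p μ) (h : ∀ x, f x ≤ g x) :
    toLpClass p μ f ≤ toLpClass p μ g := by
  rw [toLpClass_eq hf, toLpClass_eq hg, ← Lp.coeFn_le]
  filter_upwards [hf.coeFn_toLp, hg.coeFn_toLp] with x h1 h2
  rw [h1, h2]
  exact h x

theorem toLpClass_add_const [IsFiniteMeasure μ] {f : X → ℝ} (hf : MemLp f p μ) (C : ℝ) :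
    toLpClass p μ (fun x => f x + C) = toLpClass p μ f + Lp.const p μ C := by
  rw [toLpClass_eq hf, toLpClass_eq (f := fun x => f x + C) (hf.add (memLp_const C)),
    ← MemLp.toLp_const, ← MemLp.toLp_add]
  rfl

theorem toLpClass_const_mul {f : X → ℝ} (hf : MemLp f p μ) (C : ℝ) :
    toLpClass p μ (fun x => C * f x) = C • toLpClass p μ f := by
  rw [toLpClass_eq hf, toLpClass_eq (f := fun x => C * f x) (hf.const_mul C), ← MemLp.toLp_const_smul]
  rfl

/-- Bounded pointwise convergence implies convergence in `L_p`. -/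
theorem tendsto_toLpClass [IsFiniteMeasure μ] [Fact (1 ≤ p)] (hp : p ≠ ⊤) {f : ℕ → X → ℝ} {g : X → ℝ} {C : ℝ}
    (hf : ∀ n, Measurable (f n)) (hC : ∀ n x, |f n x| ≤ C)
    (hfg : ∀ x, Tendsto (fun n => f n x) atTop (𝓝 (g x))) :
    Tendsto (fun n => toLpClass p μ (f n)) atTop (𝓝 (toLpClass p μ g)) := by
  have hfm : ∀ n, MemLp (f n) p μ := fun n => IsBoundedMeasurable.memLp ⟨hf n, C, hC n⟩ p μ
  have hgm : MemLp g p μ := IsBoundedMeasurable.memLp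
    ⟨measurable_of_tendsto_metrizable hf (tendsto_pi_nhds.2 hfg), C,
      fun x => le_of_tendsto (hfg x).abs (Eventually.of_forall fun n => hC n x)⟩ p μ
  rw [toLpClass_eq hgm]
  simp_rw [toLpClass_eq (hfm _)]
  rw [Lp.tendsto_Lp_iff_tendsto_eLpNorm'']
  refine tendsto_Lp_finite_of_tendsto_ae Fact.out hp (fun n => (hfm n).1) hgm ?_ (ae_of_all _ hfg)
  -- No function of the sequence reaches the level `C + 1`, so the tails vanish for every `ε`.
  refine unifIntegrable_of Fact.out hp (fun n => (hfm n).1) fun ε _ =>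
    ⟨(C + 1).toNNReal, fun n => ?_⟩
  have : {x | (C + 1).toNNReal ≤ ‖f n x‖₊} = ∅ := by
    refine eq_empty_of_forall_notMem fun x hx => ?_
    have h1 : (C + 1).toNNReal ≤ ‖f n x‖₊ := hx
    have h2 : C + 1 ≤ |f n x| := (Real.le_coe_toNNReal _).trans (NNReal.coe_le_coe.2 h1)
    linarith [hC n x]
  rw [this]
  simp

end LpClass

end RiskMDP

namespace RiskMDP

/-! ### From separate to joint continuity by monotonicity -/

section JointContinuity

variable {d k : ℕ} {S : Set (Fin d → ℝ)} {A : Set (Fin k → ℝ)} {Θ : Type*} {p : ℝ≥0∞}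

/-- The form in which order neighbourhoods are used: a bound at one fixed end point survives small
changes of the other variable, and monotonicity carries it to all states on the proper side. -/
theorem OrderNeighbourhoods.exists_Icc (hS : OrderNeighbourhoods S) {s : S} {P Q : S → Prop}
    (hP : ∀ᶠ x in 𝓝 s, P x) (hQ : ∀ᶠ x in 𝓝 s, Q x) :
    ∃ l u : S, P l ∧ Q u ∧ ∀ᶠ x in 𝓝 s, l ≤ x ∧ x ≤ u := by
  obtain ⟨l, hl, u, hu, h⟩ := hS s _ (hP.and hQ)
  exact ⟨l, u, hl.1, hu.2, h⟩

/-- A separately continuous function that is monotone in one variable is jointly continuous. -/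
theorem OrderNeighbourhoods.continuous_of_monotone (hS : OrderNeighbourhoods S)
    {Y : Type*} [TopologicalSpace Y] {f : S → Y → ℝ} (hm : ∀ y, Monotone fun s => f s y)
    (h1 : ∀ y, Continuous fun s => f s y) (h2 : ∀ s, Continuous (f s)) :
    Continuous fun x : S × Y => f x.1 x.2 := by
  refine continuous_iff_continuousAt.2 fun ⟨s, y⟩ => tendsto_order.2 ⟨fun r hr => ?_, fun r hr => ?_⟩
  · obtain ⟨l, u, hl, -, hlu⟩ := hS.exists_Icc
      ((h1 y).continuousAt.eventually_const_lt hr) (Eventually.of_forall fun _ => trivial)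
    rw [nhds_prod_eq]
    filter_upwards [hlu.prod_mk ((h2 l).continuousAt.eventually_const_lt hl)] with x hx
    exact hx.2.trans_le (hm _ hx.1.1)
  · obtain ⟨l, u, -, hu, hlu⟩ := hS.exists_Icc (Eventually.of_forall fun _ => trivial)
      ((h1 y).continuousAt.eventually_lt_const hr)
    rw [nhds_prod_eq]
    filter_upwards [hlu.prod_mk ((h2 u).continuousAt.eventually_lt_const hu)] with x hx
    exact (hm _ hx.1.2).trans_lt hx.2

/-- Nearby values are contained in the value at the lower end point `l`, which stays inside the open
set as `y` moves. -/
theorem OrderNeighbourhoods.upperHemicontinuous_of_antitone (hS : OrderNeighbourhoods S)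
    {Y B : Type*} [TopologicalSpace Y] [TopologicalSpace B] {Γ : S → Y → Set B}
    (hm : ∀ s s', s ≤ s' → ∀ y, Γ s' y ⊆ Γ s y)
    (h1 : ∀ y, UpperHemicontinuous fun s => Γ s y) (h2 : ∀ s, UpperHemicontinuous (Γ s)) :
    UpperHemicontinuous fun x : S × Y => Γ x.1 x.2 := by
  refine UpperHemicontinuous.of_forall_isOpen fun ⟨s, y⟩ U hU hsub => ?_
  obtain ⟨l, u, hl, -, hlu⟩ := hS.exists_Icc ((h1 y).forall_isOpen s U hU hsub)
    (Eventually.of_forall fun _ => trivial)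
  rw [nhds_prod_eq]
  filter_upwards [hlu.prod_mk ((h2 l).forall_isOpen y U hU hl)] with x hx
  exact (hm _ _ hx.1.1 _).trans hx.2

/-- Nearby values contain the value at the upper end point `u`, which keeps meeting the open set. -/
theorem OrderNeighbourhoods.lowerHemicontinuous_of_antitone (hS : OrderNeighbourhoods S)
    {Y B : Type*} [TopologicalSpace Y] [TopologicalSpace B] {Γ : S → Y → Set B}
    (hm : ∀ s s', s ≤ s' → ∀ y, Γ s' y ⊆ Γ s y)
    (h1 : ∀ y, LowerHemicontinuous fun s => Γ s y) (h2 : ∀ s, LowerHemicontinuous (Γ s)) :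
    LowerHemicontinuous fun x : S × Y => Γ x.1 x.2 := by
  rintro ⟨s, y⟩ U ⟨hU, hne⟩
  obtain ⟨l, u, -, hu, hlu⟩ := hS.exists_Icc (Eventually.of_forall fun _ => trivial)
    (h1 y s U ⟨hU, hne⟩)
  rw [nhds_prod_eq]
  filter_upwards [hlu.prod_mk (h2 u y U hu)] with x hx
  exact ⟨hx.2.1, hx.2.2.mono (inter_subset_inter_left _ (hm _ _ hx.1.2 _))⟩

/-- The part of `S` above `x`. -/
def upperOrthant (S : Set (Fin d → ℝ)) (x : Fin d → ℝ) : Set S := {y | x ≤ (y : Fin d → ℝ)}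

theorem isClosed_upperOrthant (x : Fin d → ℝ) : IsClosed (upperOrthant S x) :=
  isClosed_Ici.preimage continuous_subtype_val

/-- The corners range over the whole coordinate space, so the supremum of two corners is available
although `S` need not be a lattice. -/
theorem isPiSystem_upperOrthant : IsPiSystem (range (upperOrthant S)) := by
  rintro _ ⟨x, rfl⟩ _ ⟨y, rfl⟩ -
  refine ⟨x ⊔ y, ?_⟩
  ext z
  exact (sup_le_iff (a := x) (b := y) (c := (z : Fin d → ℝ)))

/-- Half-open boxes in `S`. -/
def halfOpenBox (S : Set (Fin d → ℝ)) (x : (Fin d → ℝ) × (Fin d → ℝ)) : Set S :=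
  {y | x.1 ≤ (y : Fin d → ℝ) ∧ ∀ i, (y : Fin d → ℝ) i < x.2 i}

/-- A point above `a` violates the `i`-th upper bound iff it lies in the orthant whose corner is `a`
with coordinate `i` raised to `b i`. The maximum with `a i` keeps that orthant inside the one of `a`
even if `b i < a i`. -/
theorem halfOpenBox_eq_diff (a b : Fin d → ℝ) :
    halfOpenBox S (a, b) = upperOrthant S a \
      ⋃ t ∈ (Finset.univ.image fun i => upperOrthant S (Function.update a i (max (a i) (b i)))),
        t := by
  ext y
  have h : ∀ i, a ≤ (y : Fin d → ℝ) →
      (Function.update a i (max (a i) (b i)) ≤ (y : Fin d → ℝ) ↔ b i ≤ (y : Fin d → ℝ) i) := by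
    intro i ha
    rw [update_le_iff]
    exact ⟨fun h => (le_max_right _ _).trans h.1, fun h => ⟨max_le (ha i) h, fun j _ => ha j⟩⟩
  constructor
  · rintro ⟨ha, hb⟩
    refine ⟨ha, ?_⟩
    simp only [Finset.mem_image, Finset.mem_univ, true_and, iUnion_exists, iUnion_iUnion_eq',
      mem_iUnion, not_exists]
    exact fun i hi => absurd ((h i ha).1 hi) (not_le.2 (hb i))
  · rintro ⟨ha, hb⟩
    refine ⟨ha, fun i => ?_⟩
    simp only [Finset.mem_image, Finset.mem_univ, true_and, iUnion_exists, iUnion_iUnion_eq',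
      mem_iUnion, not_exists] at hb
    exact not_le.1 fun hle => hb i ((h i ha).2 hle)

theorem isPiSystem_halfOpenBox : IsPiSystem (range (halfOpenBox S)) := by
  rintro _ ⟨x, rfl⟩ _ ⟨y, rfl⟩ -
  refine ⟨(x.1 ⊔ y.1, x.2 ⊓ y.2), ?_⟩
  ext z
  simp only [halfOpenBox, mem_ofPred_eq, mem_inter_iff, sup_le_iff, Pi.inf_apply, lt_inf_iff,
    forall_and]
  tauto

theorem measurableSet_halfOpenBox (x : (Fin d → ℝ) × (Fin d → ℝ)) :
    MeasurableSet (halfOpenBox S x) := by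
  obtain ⟨a, b⟩ := x
  rw [halfOpenBox_eq_diff]
  refine (isClosed_upperOrthant a).measurableSet.diff (Finset.measurableSet_biUnion _ ?_)
  simp only [Finset.mem_image, Finset.mem_univ, true_and]
  rintro _ ⟨i, rfl⟩
  exact (isClosed_upperOrthant _).measurableSet

theorem exists_halfOpenBox_subset {U : Set S} (hU : IsOpen U) {x : S} (hx : x ∈ U) :
    ∃ y, halfOpenBox S y ∈ 𝓝 x ∧ halfOpenBox S y ⊆ U := by
  obtain ⟨ε, hε, hsub⟩ := Metric.isOpen_iff.1 hU x hx
  refine ⟨(fun i => (x : Fin d → ℝ) i - ε / 2, fun i => (x : Fin d → ℝ) i + ε / 2), ?_, ?_⟩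
  · refine Metric.mem_nhds_iff.2 ⟨ε / 2, half_pos hε, fun y hy => ?_⟩
    have h1 : ∀ i, |(y : Fin d → ℝ) i - (x : Fin d → ℝ) i| < ε / 2 :=
      (dist_pi_lt_iff (half_pos hε)).1 hy
    exact ⟨fun i => by linarith [(abs_lt.1 (h1 i)).1], fun i => by linarith [(abs_lt.1 (h1 i)).2]⟩
  · rintro y ⟨h1, h2⟩
    refine hsub ((dist_pi_lt_iff hε).2 fun i => abs_lt.2 ⟨?_, ?_⟩)
    · have : (x : Fin d → ℝ) i - ε / 2 ≤ (y : Fin d → ℝ) i := h1 i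
      linarith
    · have : (y : Fin d → ℝ) i < (x : Fin d → ℝ) i + ε / 2 := h2 i
      linarith

/-- Convergence of the probabilities of all upper orthants implies weak convergence. -/
theorem tendsto_of_forall_tendsto_upperOrthant {ι : Type*} {L : Filter ι}
    [L.IsCountablyGenerated] {μ : ι → ProbabilityMeasure S} {ν : ProbabilityMeasure S}
    (h : ∀ x, Tendsto (fun i => (μ i : Measure S).real (upperOrthant S x)) L
      (𝓝 ((ν : Measure S).real (upperOrthant S x)))) : Tendsto μ L (𝓝 ν) := by
  refine isPiSystem_halfOpenBox.tendsto_probabilityMeasure_of_tendsto_of_mem ?_ ?_ ?_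
  · rintro _ ⟨x, rfl⟩
    exact measurableSet_halfOpenBox x
  · intro U hU x hx
    obtain ⟨y, h1, h2⟩ := exists_halfOpenBox_subset hU hx
    exact ⟨_, ⟨y, rfl⟩, h1, h2⟩
  · rintro _ ⟨⟨a, b⟩, rfl⟩
    set t := Finset.univ.image fun i => upperOrthant S (Function.update a i (max (a i) (b i)))
      with ht
    have hmeas : ∀ s ∈ range (upperOrthant S), MeasurableSet s := by
      rintro _ ⟨x, rfl⟩
      exact (isClosed_upperOrthant x).measurableSet
    have htS : ∀ s ∈ t, s ∈ range (upperOrthant S) := by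
      simp only [ht, Finset.mem_image, Finset.mem_univ, true_and]
      rintro _ ⟨i, rfl⟩
      exact ⟨_, rfl⟩
    have hsub : (⋃ s ∈ t, s) ⊆ upperOrthant S a := by
      refine iUnion₂_subset fun s hs => ?_
      obtain ⟨i, -, rfl⟩ := Finset.mem_image.1 hs
      intro y hy
      have hle : a ≤ Function.update a i (max (a i) (b i)) :=
        le_update_iff.2 ⟨le_max_left _ _, fun _ _ => le_rfl⟩
      exact hle.trans hy
    -- Inclusion–exclusion: intersections of orthants are orthants, so the probabilities of their
    -- finite unions converge too.
    have h1 := isPiSystem_upperOrthant.tendsto_measureReal_biUnion htS hmeas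
      (μ := fun i => (μ i : Measure S)) (ν := (ν : Measure S)) (l := L)
      (by rintro _ ⟨x, rfl⟩; exact h x)
    have h2 : ∀ m : ProbabilityMeasure S, ((m (halfOpenBox S (a, b)) : NNReal) : ℝ) =
        (m : Measure S).real (upperOrthant S a) - (m : Measure S).real (⋃ s ∈ t, s) := fun m => by
      rw [halfOpenBox_eq_diff, ← measureReal_sdiff hsub
        (Finset.measurableSet_biUnion _ fun s hs => hmeas s (htS s hs))]
      rfl
    rw [← NNReal.tendsto_coe]
    simp only [h2]
    exact (h a).sub h1

theorem SetwiseContinuous.continuous_measureReal {Y : Type*} [TopologicalSpace Y]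
    {q : Y → ProbabilityMeasure S} (hq : SetwiseContinuous q) {B : Set S} (hB : MeasurableSet B) :
    Continuous fun y => (q y : Measure S).real B := by
  have := hq (B.indicator 1) (measurable_one.indicator hB) ⟨1, fun x => by
    by_cases hx : x ∈ B <;> simp [hx]⟩
  simpa only [integral_indicator_one hB] using this

variable [MetricSpace Θ]

/-- Each orthant probability is monotone in the state by stochastic order and separately continuous
by setwise continuity, hence jointly continuous; orthants determine weak convergence. -/
theorem Model.continuous_kernel (hS : OrderNeighbourhoods S) {M : Model S A Θ p}
    (hmono : M.IsMonotone) (hcont : M.IsSepContinuous) (t : ℕ) :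
    Continuous fun y : S × A × Θ => (M.stage t).q y.1 y.2.1 y.2.2 := by
  refine continuous_iff_continuousAt.2 fun y₀ => tendsto_of_forall_tendsto_upperOrthant fun x => ?_
  have hx := (isClosed_upperOrthant (S := S) x).measurableSet
  exact (hS.continuous_of_monotone
    (f := fun s (y : A × Θ) => ((M.stage t).q s y.1 y.2 : Measure S).real (upperOrthant S x))
    (fun y s s' hs => ENNReal.toReal_mono (measure_ne_top _ _) (hmono.kernel t s s' hs y.1 y.2 x))
    (fun y => ((hcont.kernel_state t y.2).continuous_measureReal hx).comp
      (f := fun s => (s, y.1)) (by fun_prop))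
    (fun s => (hcont.kernel_param t s).continuous_measureReal hx)).tendsto y₀

theorem Model.continuous_cost (hS : OrderNeighbourhoods S) {M : Model S A Θ p}
    (hmono : M.IsMonotone) (hcont : M.IsSepContinuous) (t : ℕ) :
    Continuous fun y : S × A × Θ => (M.stage t).c y.1 y.2.1 y.2.2 :=
  hS.continuous_of_monotone (f := fun s (y : A × Θ) => (M.stage t).c s y.1 y.2)
    (fun y s s' hs => hmono.cost t s s' hs y.1 y.2)
    (fun y => (hcont.cost_state t y.2).comp (f := fun s => (s, y.1)) (by fun_prop))
    (fun s => hcont.cost_param t s)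

theorem Model.continuous_terminal (hS : OrderNeighbourhoods S) {M : Model S A Θ p}
    (hmono : M.IsMonotone) (hcont : M.IsSepContinuous) :
    Continuous fun y : S × Θ => M.cT y.1 y.2 :=
  hS.continuous_of_monotone (fun θ s s' hs => hmono.terminal s s' hs θ)
    hcont.terminal_state hcont.terminal_param

theorem Model.upperHemicontinuous_action (hS : OrderNeighbourhoods S) {M : Model S A Θ p}
    (hmono : M.IsMonotone) (hcont : M.IsSepContinuous) :
    UpperHemicontinuous fun y : S × Θ => M.Γ y.1 y.2 :=
  hS.upperHemicontinuous_of_antitone (fun s s' hs θ => hmono.action s s' hs θ)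
    (fun θ => (hcont.action_state θ).1) (fun s => (hcont.action_param s).1)

theorem Model.lowerHemicontinuous_action (hS : OrderNeighbourhoods S) {M : Model S A Θ p}
    (hmono : M.IsMonotone) (hcont : M.IsSepContinuous) :
    LowerHemicontinuous fun y : S × Θ => M.Γ y.1 y.2 :=
  hS.lowerHemicontinuous_of_antitone (fun s s' hs θ => hmono.action s s' hs θ)
    (fun θ => (hcont.action_state θ).2) (fun s => (hcont.action_param s).2)

end JointContinuity

end RiskMDP

noncomputable section

namespace RiskMDP

variable {d k : ℕ} {S : Set (Fin d → ℝ)} {A : Set (Fin k → ℝ)} {Θ : Type*} {p : ℝ≥0∞}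

/-- One-step conditional risk of a function of the next state, given the state and the action. -/
def Stage.risk (m : Stage S A Θ p) (f : S → ℝ) (s : S) (a : A) (θ : Θ) : ℝ :=
  m.σ (toLpClass p (m.Q : Measure S) f) s (m.q s a θ) θ

/-! ### The one-step risk -/

section Risk

variable {m : Stage S A Θ p} {Γ : S → Θ → Set A} {f g : S → ℝ} {s : S} {a : A} {θ : Θ}

theorem Stage.IsMarkovCoherent.risk_mono (h : m.IsMarkovCoherent Γ) (ha : a ∈ Γ s θ)
    (hf : IsBoundedMeasurable f) (hg : IsBoundedMeasurable g) (hfg : ∀ x, f x ≤ g x) :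
    m.risk f s a θ ≤ m.risk g s a θ :=
  (h.coherent s θ a ha).monotone _ _ (toLpClass_mono (hf.memLp p _) (hg.memLp p _) hfg)

theorem Stage.IsMarkovCoherent.risk_add_const (h : m.IsMarkovCoherent Γ) (ha : a ∈ Γ s θ)
    (hf : IsBoundedMeasurable f) (C : ℝ) :
    m.risk (fun x => f x + C) s a θ = m.risk f s a θ + C := by
  unfold Stage.risk
  rw [toLpClass_add_const (hf.memLp p _)]
  exact (h.coherent s θ a ha).translation _ _

theorem Stage.IsMarkovCoherent.risk_const_mul (h : m.IsMarkovCoherent Γ) (ha : a ∈ Γ s θ)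
    (hf : IsBoundedMeasurable f) {C : ℝ} (hC : 0 < C) :
    m.risk (fun x => C * f x) s a θ = C * m.risk f s a θ := by
  unfold Stage.risk
  rw [toLpClass_const_mul (hf.memLp p _)]
  exact (h.coherent s θ a ha).homogeneous _ _ hC

theorem Stage.IsMarkovCoherent.risk_const (h : m.IsMarkovCoherent Γ) (ha : a ∈ Γ s θ) (C : ℝ) :
    m.risk (fun _ => C) s a θ = C := by
  unfold Stage.risk
  rw [toLpClass_eq (memLp_const C), MemLp.toLp_const]
  exact (h.coherent s θ a ha).map_const C

/-- From `f ≤ g + C`, monotonicity and translation equivariance give one half, and symmetry the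
other. This sup-norm bound is the source of every contraction estimate below. -/
theorem Stage.IsMarkovCoherent.abs_risk_sub_le (h : m.IsMarkovCoherent Γ) (ha : a ∈ Γ s θ)
    (hf : IsBoundedMeasurable f) (hg : IsBoundedMeasurable g) {C : ℝ}
    (hfg : ∀ x, |f x - g x| ≤ C) : |m.risk f s a θ - m.risk g s a θ| ≤ C := by
  have key : ∀ {f g : S → ℝ}, IsBoundedMeasurable f → IsBoundedMeasurable g →
      (∀ x, |f x - g x| ≤ C) → m.risk f s a θ ≤ m.risk g s a θ + C := fun {f g} hf hg hfg => by
    rw [← h.risk_add_const ha hg C]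
    refine h.risk_mono ha hf ?_ fun x => by linarith [(abs_le.1 (hfg x)).2]
    obtain ⟨hm, K, hK⟩ := hg
    exact ⟨hm.add_const C, K + |C|, fun x => (abs_add_le _ _).trans (by gcongr; exact hK x)⟩
  refine abs_le.2 ⟨?_, ?_⟩
  · linarith [key hg hf fun x => by rw [abs_sub_comm]; exact hfg x]
  · linarith [key hf hg hfg]

theorem isBoundedMeasurable_const (C : ℝ) : IsBoundedMeasurable fun _ : S => C :=
  ⟨measurable_const, |C|, fun _ => le_rfl⟩

theorem Stage.IsMarkovCoherent.abs_risk_le (h : m.IsMarkovCoherent Γ) (ha : a ∈ Γ s θ)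
    (hf : IsBoundedMeasurable f) {C : ℝ} (hfC : ∀ x, |f x| ≤ C) : |m.risk f s a θ| ≤ C := by
  have := h.abs_risk_sub_le ha hf (isBoundedMeasurable_const 0) (C := C) (by simpa using hfC)
  rwa [h.risk_const ha, sub_zero] at this

/-- The risk of a fixed position is continuous along the triples at which the envelope is
continuous. -/
theorem Stage.EnvelopeContinuous.continuousOn_risk [Fact (1 ≤ p)] [TopologicalSpace Θ]
    (henv : m.EnvelopeContinuous Γ) (h : m.IsMarkovCoherent Γ)
    (v : Lp ℝ p (m.Q : Measure S)) :
    ContinuousOn (fun x : S × ProbabilityMeasure S × Θ => m.σ v x.1 x.2.1 x.2.2)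
      {x | ∃ a ∈ Γ x.1 x.2.2, x.2.1 = m.q x.1 a x.2.2} := by
  -- On feasible triples the risk is the maximum of `φ v` over the envelope. Lower hemicontinuity
  -- keeps it from dropping, since a density near the maximizer survives; upper hemicontinuity keeps
  -- it from jumping up, since nearby maximizers stay in `{φ | φ v < r}`.
  have hcoh : ∀ x ∈ {x : S × ProbabilityMeasure S × Θ | ∃ a ∈ Γ x.1 x.2.2, x.2.1 = m.q x.1 a x.2.2},
      ∃ φ ∈ m.envelope x.1 x.2.1 x.2.2, φ v = m.σ v x.1 x.2.1 x.2.2 := by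
    rintro ⟨s, μ, θ⟩ ⟨a, ha, hμ⟩
    obtain rfl : μ = m.q s a θ := hμ
    obtain ⟨φ, h1, h2, h3, h4⟩ := (h.coherent s θ a ha).exists_dual_eq v
    exact ⟨φ, ⟨h1, h2, h3⟩, h4⟩
  have heval : Continuous fun φ : WeakDual ℝ (Lp ℝ p (m.Q : Measure S)) => φ v :=
    WeakDual.eval_continuous v
  intro x hx
  refine tendsto_order.2 ⟨fun r hr => ?_, fun r hr => ?_⟩
  · obtain ⟨φ, hφ, hφv⟩ := hcoh x hx
    filter_upwards [henv.2 x hx {φ | r < φ v} ⟨isOpen_lt continuous_const heval, φ, hφ,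
      show r < φ v from hφv ▸ hr⟩] with y ⟨_, ψ, hψ, hψr⟩
    exact lt_of_lt_of_le (show r < ψ v from hψr) (hψ.2.2 v)
  · have hsub : m.envelope x.1 x.2.1 x.2.2 ⊆ {φ | φ v < r} := fun φ hφ =>
      show φ v < r from (hφ.2.2 v).trans_lt hr
    filter_upwards [henv.1.forall_isOpen x hx _ (isOpen_lt heval continuous_const) hsub,
      self_mem_nhdsWithin] with y hy hyB
    obtain ⟨φ, hφ, hφv⟩ := hcoh y hyB
    exact hφv ▸ hy hφ

/-- Joint continuity of the one-step risk in state, parameter and action. -/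
theorem Stage.IsMarkovCoherent.continuousOn_risk [Fact (1 ≤ p)] (hp : p ≠ ⊤) [MetricSpace Θ]
    (h : m.IsMarkovCoherent Γ) (henv : m.EnvelopeContinuous Γ)
    (hq : Continuous fun y : S × A × Θ => m.q y.1 y.2.1 y.2.2)
    {v : S → Θ → ℝ} (hvm : ∀ θ, Measurable fun s => v s θ) (hvc : ∀ s, Continuous (v s))
    {C : ℝ} (hC : ∀ s θ, |v s θ| ≤ C) :
    ContinuousOn (fun y : (S × Θ) × A => m.risk (fun s => v s y.1.2) y.1.1 y.2 y.1.2)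
      {y | y.2 ∈ Γ y.1.1 y.1.2} := by
  rw [continuousOn_iff_continuous_domRestrict]
  -- Risk functional and position vary together: the former converges at each fixed position, the
  -- latter in `L_p` by bounded convergence, which calls for sequences.
  refine continuous_iff_seqContinuous.2 fun u x hu => ?_
  have hu' : Tendsto (fun n => (u n : (S × Θ) × A)) atTop (𝓝 x) :=
    (continuous_subtype_val.tendsto x).comp hu
  have hcont := (henv.continuousOn_risk h)
  set e : (S × Θ) × A → S × ProbabilityMeasure S × Θ :=
    fun y => (y.1.1, m.q y.1.1 y.2 y.1.2, y.1.2) with he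
  have hec : Continuous e := by
    have := hq.comp (f := fun y : (S × Θ) × A => (y.1.1, y.2, y.1.2)) (by fun_prop)
    exact (by fun_prop : Continuous fun y : (S × Θ) × A => y.1.1).prodMk
      (this.prodMk (by fun_prop))
  refine tendsto_of_forall_isCoherent
    (ρ := fun n w => m.σ w (u n).1.1.1 (m.q (u n).1.1.1 (u n).1.2 (u n).1.1.2) (u n).1.1.2)
    (ρ' := fun w => m.σ w x.1.1.1 (m.q x.1.1.1 x.1.2 x.1.1.2) x.1.1.2)
    (fun n => h.coherent _ _ _ (u n).2) (fun w => ?_)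
    (tendsto_toLpClass hp (fun n => hvm _) (fun n s => hC s _) fun s => ?_)
  · have h1 := hcont w (e x) ⟨_, x.2, rfl⟩
    exact h1.tendsto.comp (tendsto_nhdsWithin_iff.2 ⟨(hec.tendsto _).comp hu',
      Eventually.of_forall fun n => ⟨_, (u n).2, rfl⟩⟩)
  · exact ((hvc s).tendsto _).comp (((continuous_snd.comp continuous_fst).tendsto _).comp hu')

end Risk

/-- The regularity of a decision process that dynamic programming uses. -/
structure Model.IsWellPosed [Fact (1 ≤ p)] [MetricSpace Θ] (M : Model S A Θ p) : Prop where
  ne_top : p ≠ ⊤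
  regular : M.IsRegular
  kernel : ∀ t, Continuous fun y : S × A × Θ => (M.stage t).q y.1 y.2.1 y.2.2
  cost : ∀ t, Continuous fun y : S × A × Θ => (M.stage t).c y.1 y.2.1 y.2.2
  upper : UpperHemicontinuous fun x : S × Θ => M.Γ x.1 x.2
  lower : LowerHemicontinuous fun x : S × Θ => M.Γ x.1 x.2
  coherent : ∀ t, (M.stage t).IsMarkovCoherent M.Γ
  envelope : ∀ t, (M.stage t).EnvelopeContinuous M.Γ

/-- Bounded and jointly continuous functions of state and parameter. -/
def IsBoundedContinuous [TopologicalSpace Θ] (v : S → Θ → ℝ) : Prop :=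
  (Continuous fun x : S × Θ => v x.1 x.2) ∧ ∃ C, ∀ s θ, |v s θ| ≤ C

theorem IsBoundedContinuous.isBoundedMeasurable [TopologicalSpace Θ] {v : S → Θ → ℝ}
    (hv : IsBoundedContinuous v) (θ : Θ) : IsBoundedMeasurable fun s => v s θ := by
  obtain ⟨hc, C, hC⟩ := hv
  exact ⟨(hc.comp (f := fun s => (s, θ)) (by fun_prop)).measurable, C, fun s => hC s θ⟩

/-- Weighted cost of one period plus the one-step risk of the continuation `v`. -/
def Model.stepCost (M : Model S A Θ p) (w : Θ → ℝ) (t : ℕ) (v : S → Θ → ℝ) (x : S × Θ) (a : A) :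
    ℝ :=
  w x.2 * (M.stage t).c x.1 a x.2 + (M.stage t).risk (fun s => v s x.2) x.1 a x.2

theorem Model.nested_succ (M : Model S A Θ p) (w : ℕ → Θ → ℝ) (term : S → Θ → ℝ)
    (π : ℕ → S → Θ → A) (n t : ℕ) (s : S) (θ : Θ) :
    M.nested w term π (n + 1) t s θ =
      M.stepCost (w t) t (M.nested w term π n (t + 1)) (s, θ) (π t s θ) := rfl

/-- Value iteration: the minimal nested risk of `n` periods started at time `t`. -/
def Model.value (M : Model S A Θ p) (w : ℕ → Θ → ℝ) (term : S → Θ → ℝ) : ℕ → ℕ → S → Θ → ℝ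
  | 0, _ => term
  | n + 1, t => fun s θ =>
      sInf (M.stepCost (w t) t (M.value w term n (t + 1)) (s, θ) '' M.Γ s θ)

theorem Model.value_succ (M : Model S A Θ p) (w : ℕ → Θ → ℝ) (term : S → Θ → ℝ)
    (n t : ℕ) (s : S) (θ : Θ) :
    M.value w term (n + 1) t s θ =
      sInf (M.stepCost (w t) t (M.value w term n (t + 1)) (s, θ) '' M.Γ s θ) := rfl

/-! ### Changing a decision rule at one point -/

section Modify

open Classical in
/-- Change of a decision rule at one point. -/
def modifyAt (f : S → Θ → A) (s : S) (θ : Θ) (a : A) : S → Θ → A :=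
  fun s' θ' => if s' = s ∧ θ' = θ then a else f s' θ'

theorem modifyAt_self (f : S → Θ → A) (s : S) (θ : Θ) (a : A) : modifyAt f s θ a s θ = a := by
  simp [modifyAt]

/-- Single states are Borel sets, so any one greedy action can be built into a measurable optimal
rule. This shows that greedy actions are optimal actions. -/
theorem measurable_modifyAt {f : S → Θ → A} (hf : ∀ θ, Measurable fun s => f s θ) (s : S) (θ : Θ)
    (a : A) (θ' : Θ) : Measurable fun s' => modifyAt f s θ a s' θ' := by
  classical
  by_cases h : θ' = θ
  · simp only [modifyAt, h, and_true]
    exact Measurable.ite (measurableSet_singleton s) measurable_const (hf θ)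
  · simpa [modifyAt, h] using hf θ'

theorem modifyAt_mem {f : S → Θ → A} {G : S × Θ → Set A} (hf : ∀ s θ, f s θ ∈ G (s, θ)) {s : S}
    {θ : Θ} {a : A} (ha : a ∈ G (s, θ)) (s' : S) (θ' : Θ) :
    modifyAt f s θ a s' θ' ∈ G (s', θ') := by
  unfold modifyAt
  split_ifs with h
  · rw [h.1, h.2]
    exact ha
  · exact hf s' θ'

end Modify

/-! ### The Bellman operator and value iteration -/

section Bellman

variable [Fact (1 ≤ p)] [MetricSpace Θ] {M : Model S A Θ p}

theorem Model.IsWellPosed.abs_stepCost_sub_le (hM : M.IsWellPosed) {w : Θ → ℝ} {t : ℕ}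
    {v v' : S → Θ → ℝ} {s : S} {θ : Θ} {a : A} (ha : a ∈ M.Γ s θ)
    (hv : IsBoundedMeasurable fun s => v s θ) (hv' : IsBoundedMeasurable fun s => v' s θ)
    {C : ℝ} (h : ∀ x, |v x θ - v' x θ| ≤ C) :
    |M.stepCost w t v (s, θ) a - M.stepCost w t v' (s, θ) a| ≤ C := by
  have := (hM.coherent t).abs_risk_sub_le ha hv hv' h
  simpa [Model.stepCost] using this

theorem Model.IsWellPosed.stepCost_mono (hM : M.IsWellPosed) {w : Θ → ℝ} {t : ℕ}
    {v v' : S → Θ → ℝ} {s : S} {θ : Θ} {a : A} (ha : a ∈ M.Γ s θ)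
    (hv : IsBoundedMeasurable fun s => v s θ) (hv' : IsBoundedMeasurable fun s => v' s θ)
    (h : ∀ x, v x θ ≤ v' x θ) :
    M.stepCost w t v (s, θ) a ≤ M.stepCost w t v' (s, θ) a :=
  add_le_add_right ((hM.coherent t).risk_mono ha hv hv' h) _

/-- `C` depends on the stage alone. With the weight `γ θ ^ t` and zero continuation the bound decays
geometrically in `t`. -/
theorem Model.IsWellPosed.exists_abs_stepCost_le (hM : M.IsWellPosed) (t : ℕ) :
    ∃ C, 0 ≤ C ∧ ∀ (w : Θ → ℝ) (v : S → Θ → ℝ) (s : S) (θ : Θ), ∀ a ∈ M.Γ s θ, ∀ K : ℝ,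
      IsBoundedMeasurable (fun s => v s θ) → (∀ x, |v x θ| ≤ K) →
      |M.stepCost w t v (s, θ) a| ≤ |w θ| * C + K := by
  obtain ⟨C, hC⟩ := hM.regular.cost t
  refine ⟨|C|, abs_nonneg C, fun w v s θ a ha K hv hK => (abs_add_le _ _).trans ?_⟩
  refine add_le_add ?_ ((hM.coherent t).abs_risk_le ha hv hK)
  rw [abs_mul]
  refine mul_le_mul_of_nonneg_left ?_ (abs_nonneg _)
  rw [abs_of_nonneg (hC s a θ).1]
  exact (hC s a θ).2.trans (le_abs_self C)

theorem Model.IsWellPosed.continuousOn_stepCost (hM : M.IsWellPosed) {w : Θ → ℝ}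
    (hw : Continuous w) (t : ℕ) {v : S → Θ → ℝ} (hv : IsBoundedContinuous v) :
    ContinuousOn (fun y : (S × Θ) × A => M.stepCost w t v y.1 y.2)
      {y | y.2 ∈ M.Γ y.1.1 y.1.2} := by
  obtain ⟨C, hC⟩ := hv.2
  refine ContinuousOn.add (Continuous.continuousOn ?_)
    ((hM.coherent t).continuousOn_risk hM.ne_top (hM.envelope t) (hM.kernel t)
      (fun θ => (hv.isBoundedMeasurable θ).1)
      (fun s => hv.1.comp (f := fun θ => (s, θ)) (by fun_prop)) hC)
  exact (by fun_prop : Continuous fun y : (S × Θ) × A => w y.1.2).mul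
    ((hM.cost t).comp (f := fun y : (S × Θ) × A => (y.1.1, y.2, y.1.2)) (by fun_prop))

theorem Model.IsWellPosed.continuousOn_stepCost_action (hM : M.IsWellPosed) {w : Θ → ℝ}
    (hw : Continuous w) (t : ℕ) {v : S → Θ → ℝ} (hv : IsBoundedContinuous v) (x : S × Θ) :
    ContinuousOn (M.stepCost w t v x) (M.Γ x.1 x.2) :=
  (hM.continuousOn_stepCost hw t hv).comp (f := fun a => (x, a)) (by fun_prop) fun _ ha => ha

theorem Model.IsWellPosed.nonempty_argminOn_stepCost (hM : M.IsWellPosed) {w : Θ → ℝ}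
    (hw : Continuous w) (t : ℕ) {v : S → Θ → ℝ} (hv : IsBoundedContinuous v) (x : S × Θ) :
    (argminOn (M.stepCost w t v x) (M.Γ x.1 x.2)).Nonempty :=
  nonempty_argminOn (hM.regular.action_compact _ _) (hM.regular.action_nonempty _ _)
    (hM.continuousOn_stepCost_action hw t hv x)

theorem Model.IsWellPosed.isBoundedContinuous_sInf [CompactSpace Θ] (hM : M.IsWellPosed)
    {w : Θ → ℝ} (hw : Continuous w) (t : ℕ) {v : S → Θ → ℝ} (hv : IsBoundedContinuous v) :
    IsBoundedContinuous fun s θ => sInf (M.stepCost w t v (s, θ) '' M.Γ s θ) := by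
  refine ⟨continuous_sInf_image (Γ := fun x : S × Θ => M.Γ x.1 x.2) hM.upper hM.lower
    (fun _ => hM.regular.action_compact _ _) (fun _ => hM.regular.action_nonempty _ _)
    (hM.continuousOn_stepCost hw t hv), ?_⟩
  obtain ⟨W, hW⟩ := isCompact_univ.exists_bound_of_continuousOn hw.continuousOn
  obtain ⟨K, hK⟩ := hv.2
  obtain ⟨C, hC0, hC⟩ := hM.exists_abs_stepCost_le t
  refine ⟨W * C + K, fun s θ => ?_⟩
  obtain ⟨a, ha⟩ := hM.nonempty_argminOn_stepCost hw t hv (s, θ)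
  change |sInf (M.stepCost w t v (s, θ) '' M.Γ (s, θ).1 (s, θ).2)| ≤ W * C + K
  rw [sInf_image_eq_of_mem_argminOn ha]
  refine (hC w v s θ a ha.1 K (hv.isBoundedMeasurable θ) fun x => hK x θ).trans ?_
  gcongr
  exact hW θ (mem_univ θ)

theorem Model.IsWellPosed.isBoundedContinuous_value [CompactSpace Θ] (hM : M.IsWellPosed)
    {w : ℕ → Θ → ℝ} (hw : ∀ t, Continuous (w t)) {term : S → Θ → ℝ}
    (hterm : IsBoundedContinuous term) (n t : ℕ) : IsBoundedContinuous (M.value w term n t) := by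
  induction n generalizing t with
  | zero => exact hterm
  | succ n ih => exact hM.isBoundedContinuous_sInf (hw t) t (ih (t + 1))

/-- The cost of a step under a measurable feasible decision rule is bounded and measurable. -/
theorem Model.IsWellPosed.isBoundedMeasurable_stepCost (hM : M.IsWellPosed) (w : Θ → ℝ) (t : ℕ)
    {v : S → Θ → ℝ} {θ : Θ} (hv : IsBoundedMeasurable fun s => v s θ) {g : S → A}
    (hg : Measurable g) (hgΓ : ∀ s, g s ∈ M.Γ s θ) :
    IsBoundedMeasurable fun s => M.stepCost w t v (s, θ) (g s) := by
  obtain ⟨C, hC⟩ := hv.2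
  constructor
  -- Under a measurable policy the continuation is merely measurable in the state. That is enough
  -- for joint continuity of the risk once the continuation is frozen at `θ`, which makes it
  -- constant in the parameter.
  · have h1 := (hM.coherent t).continuousOn_risk hM.ne_top (hM.envelope t) (hM.kernel t)
      (v := fun s _ => v s θ) (fun _ => hv.1) (fun _ => continuous_const) (fun s _ => hC s)
    have h2 : ContinuousOn
        (fun y : S × A => w θ * (M.stage t).c y.1 y.2 θ + (M.stage t).risk (fun s => v s θ) y.1 y.2 θ)
        {y | y.2 ∈ M.Γ y.1 θ} := by
      refine ContinuousOn.add (Continuous.continuousOn ?_)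
        (h1.comp (f := fun y : S × A => ((y.1, θ), y.2)) (by fun_prop) fun y hy => hy)
      exact continuous_const.mul
        ((hM.cost t).comp (f := fun y : S × A => (y.1, y.2, θ)) (by fun_prop))
    rw [continuousOn_iff_continuous_domRestrict] at h2
    exact h2.measurable.comp ((measurable_id.prodMk hg).subtype_mk (h := hgΓ))
  · obtain ⟨C', _, hC'⟩ := hM.exists_abs_stepCost_le t
    exact ⟨_, fun s => hC' w v s θ (g s) (hgΓ s) C hv hC⟩

theorem Model.IsWellPosed.isBoundedMeasurable_nested (hM : M.IsWellPosed)
    (w : ℕ → Θ → ℝ) {term : S → Θ → ℝ} (hterm : IsBoundedContinuous term)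
    {π : ℕ → S → Θ → A} (hπ : π ∈ M.policies) (n t : ℕ) (θ : Θ) :
    IsBoundedMeasurable fun s => M.nested w term π n t s θ := by
  induction n generalizing t with
  | zero => exact hterm.isBoundedMeasurable θ
  | succ n ih =>
    exact hM.isBoundedMeasurable_stepCost (w t) t (ih (t + 1)) (hπ.1 t θ) fun s => hπ.2 t s θ

/-- Backward induction: minimizing over the current action and, by monotonicity of the risk,
lowering the continuation both decrease the cost. -/
theorem Model.IsWellPosed.value_le_nested [CompactSpace Θ] (hM : M.IsWellPosed)
    {w : ℕ → Θ → ℝ} (hw : ∀ t, Continuous (w t)) {term : S → Θ → ℝ}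
    (hterm : IsBoundedContinuous term) {π : ℕ → S → Θ → A} (hπ : π ∈ M.policies)
    (n t : ℕ) (s : S) (θ : Θ) : M.value w term n t s θ ≤ M.nested w term π n t s θ := by
  induction n generalizing t s with
  | zero => exact le_rfl
  | succ n ih =>
    have hv := hM.isBoundedContinuous_value hw hterm n (t + 1)
    refine (sInf_image_le_of_isCompact (hM.regular.action_compact _ _)
      (hM.continuousOn_stepCost_action (hw t) t hv (s, θ)) (hπ.2 t s θ)).trans ?_
    exact hM.stepCost_mono (hπ.2 t s θ) (hv.isBoundedMeasurable θ)
      (hM.isBoundedMeasurable_nested w hterm hπ n (t + 1) θ) fun x => ih (t + 1) x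

/-- The actions that attain the minimum in the Bellman equation with continuation `v`. -/
def Model.greedy (M : Model S A Θ p) (w : Θ → ℝ) (t : ℕ) (v : S → Θ → ℝ) (x : S × Θ) : Set A :=
  argminOn (M.stepCost w t v x) (M.Γ x.1 x.2)

theorem Model.IsWellPosed.isCompact_greedy (hM : M.IsWellPosed) {w : Θ → ℝ}
    (hw : Continuous w) (t : ℕ) {v : S → Θ → ℝ} (hv : IsBoundedContinuous v) (x : S × Θ) :
    IsCompact (M.greedy w t v x) :=
  isCompact_argminOn (hM.regular.action_compact _ _) (hM.continuousOn_stepCost_action hw t hv x)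

theorem Model.IsWellPosed.upperHemicontinuous_greedy (hM : M.IsWellPosed) {w : Θ → ℝ}
    (hw : Continuous w) (t : ℕ) {v : S → Θ → ℝ} (hv : IsBoundedContinuous v) :
    UpperHemicontinuous (M.greedy w t v) :=
  upperHemicontinuous_argminOn (Γ := fun x : S × Θ => M.Γ x.1 x.2) hM.upper hM.lower
    (fun _ => hM.regular.action_compact _ _) (fun _ => hM.regular.action_nonempty _ _)
    (hM.continuousOn_stepCost hw t hv)

/-- A selection of minimizers of `h` over a compact-valued upper hemicontinuous correspondence:
measurable in the state, with lower semicontinuous value of `h`. -/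
theorem exists_selection {G : S × Θ → Set A} (hG : UpperHemicontinuous G)
    (hne : ∀ x, (G x).Nonempty) (hc : ∀ x, IsCompact (G x)) {h : A → ℝ} (hh : Continuous h) :
    ∃ f : S → Θ → A, (∀ θ, Measurable fun s => f s θ) ∧
      (∀ s θ, f s θ ∈ argminOn h (G (s, θ))) ∧
      LowerSemicontinuous fun x : S × Θ => h (f x.1 x.2) := by
  have hsel : ∀ θ, ∃ f : S → A, Measurable f ∧ ∀ s, f s ∈ argminOn h (G (s, θ)) := fun θ => by
    have h1 : IsMeasurableCompact fun s => G (s, θ) :=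
      isMeasurableCompact_of_upperHemicontinuous (fun s => hne _) (fun s => hc _)
        (UpperHemicontinuous.of_forall_isOpen fun s U hU hsub =>
          ((by fun_prop : Continuous fun s : S => (s, θ)).tendsto s).eventually
            (hG.forall_isOpen (s, θ) U hU hsub))
    exact (h1.argminOn hh).exists_measurable_selection (fun i a => (a : Fin k → ℝ) i)
      (fun i => (continuous_apply i).comp continuous_subtype_val) fun a b hab => Subtype.ext (funext hab)
  choose f hf1 hf2 using hsel
  -- The selections for different `θ` are unrelated. Only the value of `h` matters, and it is the
  -- minimum of `h` over `G`, lower semicontinuous by Berge.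
  refine ⟨fun s θ => f θ s, hf1, fun s θ => hf2 θ s, ?_⟩
  have h2 := lowerSemicontinuous_sInf_image (F := fun _ => h) hG hc hne
    (hh.comp continuous_snd).continuousOn
  convert h2 using 2 with x
  exact (sInf_image_eq_of_mem_argminOn (hf2 x.2 x.1)).symm

end Bellman

end RiskMDP

end

noncomputable section

namespace RiskMDP

variable {d k : ℕ} {S : Set (Fin d → ℝ)} {A : Set (Fin k → ℝ)} {Θ : Type*} {p : ℝ≥0∞}

section Greedy

variable {M : Model S A Θ p}

theorem Model.mem_policies_of_forall_mem_greedy {w : ℕ → Θ → ℝ} {v : ℕ → S → Θ → ℝ}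
    {π : ℕ → S → Θ → A} (hm : ∀ t θ, Measurable fun s => π t s θ)
    (hg : ∀ t s θ, π t s θ ∈ M.greedy (w t) t (v t) (s, θ)) : π ∈ M.policies :=
  ⟨hm, fun t s θ => (hg t s θ).1⟩

/-- A policy that attains the minima in the value iteration attains the value. -/
theorem Model.nested_eq_value (w : ℕ → Θ → ℝ) (term : S → Θ → ℝ) {T : ℕ} {π : ℕ → S → Θ → A}
    (hg : ∀ t s θ,
      π t s θ ∈ M.greedy (w t) t (M.value w term (T - t - 1) (t + 1)) (s, θ))
    (n t : ℕ) (hT : t + n = T) : M.nested w term π n t = M.value w term n t := by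
  induction n generalizing t with
  | zero => rfl
  | succ n ih =>
    funext s θ
    rw [Model.nested_succ, Model.value_succ, ih (t + 1) (by omega)]
    have h := hg t s θ
    rw [show T - t - 1 = n by omega] at h
    exact (sInf_image_eq_of_mem_argminOn h).symm

theorem Model.stepCost_eq_of_stationary (hst : ∀ t, M.stage t = M.stage 0) (w : Θ → ℝ) (t : ℕ)
    (v : S → Θ → ℝ) : M.stepCost w t v = M.stepCost w 0 v := by
  funext x a
  simp only [Model.stepCost, hst t]

end Greedy

/-! ### Finite horizon -/

section FiniteHorizon

variable [Fact (1 ≤ p)] [MetricSpace Θ] [CompactSpace Θ] {M : Model S A Θ p}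

theorem Model.IsWellPosed.isMinOn_finiteCost (hM : M.IsWellPosed)
    (hterm : IsBoundedContinuous M.cT) {T : ℕ} {π : ℕ → S → Θ → A}
    (hg : ∀ t s θ, π t s θ ∈ M.greedy (fun _ => 1) t
      (M.value (fun _ _ => 1) M.cT (T - t - 1) (t + 1)) (s, θ))
    {t : ℕ} (ht : t ≤ T) (s : S) (θ : Θ) : IsMinOn (M.finiteCost T t s θ) M.policies π :=
  isMinOn_iff.2 fun π' hπ' => by
    unfold Model.finiteCost
    rw [Model.nested_eq_value _ _ hg (T - t) t (by omega)]
    exact hM.value_le_nested (fun _ => continuous_const) hterm hπ' _ _ _ _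

/-- Policies are defined at all times. For `t ≥ T` the truncated subtraction leaves `0` periods, so
the rule there is greedy for `M.cT`; it does not enter the costs up to `T`. -/
theorem Model.IsWellPosed.exists_greedy_policy (hM : M.IsWellPosed)
    (hterm : IsBoundedContinuous M.cT) (T : ℕ) {h : ℕ → A → ℝ} (hh : ∀ t, Continuous (h t)) :
    ∃ π ∈ M.policies, (∀ t s θ, π t s θ ∈ argminOn (h t) (M.greedy (fun _ => 1) t
      (M.value (fun _ _ => 1) M.cT (T - t - 1) (t + 1)) (s, θ))) ∧
      ∀ t, LowerSemicontinuous fun x : S × Θ => h t (π t x.1 x.2) := by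
  have hv : ∀ n t, IsBoundedContinuous (M.value (fun _ _ => 1) M.cT n t) :=
    hM.isBoundedContinuous_value (fun _ => continuous_const) hterm
  choose π h1 h2 h3 using fun t => exists_selection
    (hM.upperHemicontinuous_greedy (w := fun _ => 1) continuous_const t (hv (T - t - 1) (t + 1)))
    (hM.nonempty_argminOn_stepCost continuous_const t (hv (T - t - 1) (t + 1)))
    (hM.isCompact_greedy continuous_const t (hv (T - t - 1) (t + 1))) (hh t)
  exact ⟨π, Model.mem_policies_of_forall_mem_greedy h1 fun t s θ => (h2 t s θ).1, h2, h3⟩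

theorem Model.IsWellPosed.isLeast_finiteValue (hM : M.IsWellPosed)
    (hterm : IsBoundedContinuous M.cT) {T t : ℕ} (ht : t ≤ T) (s : S) (θ : Θ) :
    IsLeast (M.finiteCost T t s θ '' M.policies) (M.finiteValue T t s θ) ∧
      M.finiteValue T t s θ = M.value (fun _ _ => 1) M.cT (T - t) t s θ := by
  obtain ⟨π, hπ, hg, -⟩ := hM.exists_greedy_policy hterm T (h := fun _ _ => 0)
    fun _ => continuous_const
  have hg' := fun t s θ => (hg t s θ).1
  have hmin := hM.isMinOn_finiteCost hterm hg' ht s θ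
  have hleast : IsLeast (M.finiteCost T t s θ '' M.policies) (M.finiteCost T t s θ π) :=
    ⟨mem_image_of_mem _ hπ, by rintro _ ⟨π', hπ', rfl⟩; exact isMinOn_iff.1 hmin π' hπ'⟩
  have hval : M.finiteValue T t s θ = M.finiteCost T t s θ π := hleast.csInf_eq
  refine ⟨hval ▸ hleast, hval.trans ?_⟩
  unfold Model.finiteCost
  rw [Model.nested_eq_value _ _ hg' (T - t) t (by omega)]

/-- The Bellman cost of the action of a policy optimal at `(s, θ)` is at most the cost of that
policy, hence the minimum. Conversely, a greedy policy changed at `(t, s, θ)` to another greedy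
action remains greedy everywhere, so it is optimal. -/
theorem Model.IsWellPosed.finiteOptimalActions_eq (hM : M.IsWellPosed)
    (hterm : IsBoundedContinuous M.cT) {T t : ℕ} (ht : t < T) (s : S) (θ : Θ) :
    M.finiteOptimalActions T t s θ = M.greedy (fun _ => 1) t
      (M.value (fun _ _ => 1) M.cT (T - t - 1) (t + 1)) (s, θ) := by
  have hv : ∀ n t, IsBoundedContinuous (M.value (fun _ _ => 1) M.cT n t) :=
    hM.isBoundedContinuous_value (fun _ => continuous_const) hterm
  obtain ⟨π, hπ, hg, -⟩ := hM.exists_greedy_policy hterm T (h := fun _ _ => 0)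
    fun _ => continuous_const
  have hg' := fun t s θ => (hg t s θ).1
  obtain ⟨n, hn⟩ : ∃ n, T - t = n + 1 := ⟨T - t - 1, by omega⟩
  have hn' : T - t - 1 = n := by omega
  ext a
  constructor
  · rintro ⟨π', hπ', rfl, hmin⟩
    rw [hn']
    refine mem_argminOn_of_le (hM.regular.action_compact _ _)
      (hM.continuousOn_stepCost_action continuous_const t (hv n (t + 1)) (s, θ)) (hπ'.2 t s θ) ?_
    have h1 : M.stepCost (fun _ => 1) t (M.value (fun _ _ => 1) M.cT n (t + 1)) (s, θ)
        (π' t s θ) ≤ M.finiteCost T t s θ π' := by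
      unfold Model.finiteCost
      rw [hn, Model.nested_succ]
      exact hM.stepCost_mono (hπ'.2 t s θ) ((hv n (t + 1)).isBoundedMeasurable θ)
        (hM.isBoundedMeasurable_nested _ hterm hπ' n (t + 1) θ)
        fun x => hM.value_le_nested (fun _ => continuous_const) hterm hπ' _ _ _ _
    refine h1.trans ((isMinOn_iff.1 hmin π hπ).trans_eq ?_)
    unfold Model.finiteCost
    rw [Model.nested_eq_value _ _ hg' (T - t) t (by omega), hn, Model.value_succ]
  · intro ha
    set π' : ℕ → S → Θ → A := Function.update π t (modifyAt (π t) s θ a) with hπ'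
    have hgreedy : ∀ u s θ, π' u s θ ∈ M.greedy (fun _ => 1) u
        (M.value (fun _ _ => 1) M.cT (T - u - 1) (u + 1)) (s, θ) := fun u s' θ' => by
      rcases eq_or_ne u t with rfl | hu
      · rw [hπ', Function.update_self]
        exact modifyAt_mem (hg' u) ha s' θ'
      · rw [hπ', Function.update_of_ne hu]
        exact hg' u s' θ'
    refine ⟨π', Model.mem_policies_of_forall_mem_greedy (fun u θ' => ?_) hgreedy, ?_,
      hM.isMinOn_finiteCost hterm hgreedy ht.le s θ⟩
    · rcases eq_or_ne u t with rfl | hu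
      · rw [hπ', Function.update_self]
        exact measurable_modifyAt (hπ.1 u) s θ a θ'
      · rw [hπ', Function.update_of_ne hu]
        exact hπ.1 u θ'
    · rw [hπ', Function.update_self, modifyAt_self]

theorem Model.IsWellPosed.finite_horizon (hM : M.IsWellPosed)
    (hterm : IsBoundedContinuous M.cT) (T : ℕ) :
    (∀ π ∈ M.policies, ∀ t < T, ∀ θ,
        MemLp (fun s => M.finiteCost T (t + 1) s θ π) p ((M.stage t).Q : Measure S)) ∧
      (∀ t ≤ T,
        (∀ s θ, IsLeast (M.finiteCost T t s θ '' M.policies) (M.finiteValue T t s θ)) ∧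
        Continuous fun x : S × Θ => M.finiteValue T t x.1 x.2) ∧
      (∀ t < T,
        (∀ s θ, (M.finiteOptimalActions T t s θ).Nonempty ∧
          IsCompact (M.finiteOptimalActions T t s θ)) ∧
        UpperHemicontinuous fun x : S × Θ => M.finiteOptimalActions T t x.1 x.2) ∧
      (∀ h : ℕ → A → ℝ, (∀ t, Continuous (h t)) →
        ∃ π ∈ M.policies,
          (∀ t ≤ T, ∀ s θ, IsMinOn (M.finiteCost T t s θ) M.policies π) ∧
          ∀ t < T, (∀ s θ, IsMinOn (h t) (M.finiteOptimalActions T t s θ) (π t s θ)) ∧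
            LowerSemicontinuous fun x : S × Θ => h t (π t x.1 x.2)) := by
  have hv : ∀ n t, IsBoundedContinuous (M.value (fun _ _ => 1) M.cT n t) :=
    hM.isBoundedContinuous_value (fun _ => continuous_const) hterm
  refine ⟨fun π hπ t _ θ => ?_, fun t ht => ⟨fun s θ => (hM.isLeast_finiteValue hterm ht s θ).1, ?_⟩,
    fun t ht => ⟨fun s θ => ?_, ?_⟩, fun h hh => ?_⟩
  · exact (hM.isBoundedMeasurable_nested _ hterm hπ _ _ θ).memLp p _
  · simp only [(hM.isLeast_finiteValue hterm ht _ _).2]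
    exact (hv _ _).1
  · rw [hM.finiteOptimalActions_eq hterm ht]
    exact ⟨hM.nonempty_argminOn_stepCost continuous_const t (hv _ _) _,
      hM.isCompact_greedy continuous_const t (hv _ _) _⟩
  · simp only [hM.finiteOptimalActions_eq hterm ht]
    exact hM.upperHemicontinuous_greedy continuous_const t (hv _ _)
  · obtain ⟨π, hπ, hg, hl⟩ := hM.exists_greedy_policy hterm T hh
    refine ⟨π, hπ, fun t ht s θ =>
      hM.isMinOn_finiteCost hterm (fun t s θ => (hg t s θ).1) ht s θ,
      fun t ht => ⟨fun s θ => ?_, hl t⟩⟩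
    rw [hM.finiteOptimalActions_eq hterm ht]
    exact (hg t s θ).2

end FiniteHorizon

/-! ### Infinite horizon: discounting and geometric estimates -/

section InfiniteHorizon

variable [Fact (1 ≤ p)] [MetricSpace Θ] {M : Model S A Θ p}

/-- Discount weights of the infinite-horizon problem. -/
def Model.discount (M : Model S A Θ p) : ℕ → Θ → ℝ := fun t θ => M.γ θ ^ t

/-- Zero terminal cost. -/
def zeroTerminal : S → Θ → ℝ := fun _ _ => 0

theorem isBoundedContinuous_zeroTerminal :
    IsBoundedContinuous (zeroTerminal : S → Θ → ℝ) :=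
  ⟨continuous_const, 0, fun _ _ => by simp [zeroTerminal]⟩

/-- The Bellman function of the stationary discounted problem. -/
def Model.discountedStep (M : Model S A Θ p) (v : S → Θ → ℝ) (x : S × Θ) (a : A) : ℝ :=
  M.stepCost (fun _ => 1) 0 (fun s θ => M.γ θ * v s θ) x a

theorem IsBoundedMeasurable.const_mul {X : Type*} [MeasurableSpace X] {f : X → ℝ}
    (hf : IsBoundedMeasurable f) (C : ℝ) : IsBoundedMeasurable fun x => C * f x := by
  obtain ⟨hm, K, hK⟩ := hf
  exact ⟨hm.const_mul C, |C| * K, fun x => by rw [abs_mul]; gcongr; exact hK x⟩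

/-- Positive homogeneity of a step of the stationary problem. -/
theorem Model.IsWellPosed.stepCost_discount_succ (hM : M.IsWellPosed) (hγ : ∀ θ, 0 < M.γ θ)
    (hst : ∀ t, M.stage t = M.stage 0) (t : ℕ) {v : S → Θ → ℝ} {s : S} {θ : Θ} {a : A}
    (ha : a ∈ M.Γ s θ) (hv : IsBoundedMeasurable fun s => v s θ) :
    M.stepCost (M.discount (t + 1)) (t + 1) (fun s θ => M.γ θ * v s θ) (s, θ) a =
      M.γ θ * M.stepCost (M.discount t) t v (s, θ) a := by
  rw [Model.stepCost_eq_of_stationary hst _ (t + 1), Model.stepCost_eq_of_stationary hst _ t]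
  unfold Model.stepCost
  rw [(hM.coherent 0).risk_const_mul ha hv (hγ θ)]
  simp only [Model.discount, pow_succ]
  ring

/-- By positive homogeneity the discount factor passes through the risk, so a delay by one period
scales the cost of a stationary policy. This turns the recursion with time-dependent weights into
iteration of one operator. -/
theorem Model.IsWellPosed.nested_stationary_succ (hM : M.IsWellPosed) (hγ : ∀ θ, 0 < M.γ θ)
    (hst : ∀ t, M.stage t = M.stage 0) {f : S → Θ → A} (hf : stationary f ∈ M.policies)
    (n t : ℕ) : M.nested M.discount zeroTerminal (stationary f) n (t + 1) =
      fun s θ => M.γ θ * M.nested M.discount zeroTerminal (stationary f) n t s θ := by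
  induction n generalizing t with
  | zero => funext s θ; simp [Model.nested, zeroTerminal]
  | succ n ih =>
    funext s θ
    rw [Model.nested_succ, Model.nested_succ, ih (t + 1)]
    exact hM.stepCost_discount_succ hγ hst t (hf.2 t s θ)
      (hM.isBoundedMeasurable_nested _ isBoundedContinuous_zeroTerminal hf _ _ _)

theorem Model.IsWellPosed.nested_stationary (hM : M.IsWellPosed) (hγ : ∀ θ, 0 < M.γ θ)
    (hst : ∀ t, M.stage t = M.stage 0) {f : S → Θ → A} (hf : stationary f ∈ M.policies)
    (n : ℕ) (s : S) (θ : Θ) : M.nested M.discount zeroTerminal (stationary f) (n + 1) 0 s θ =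
      M.discountedStep (M.nested M.discount zeroTerminal (stationary f) n 0) (s, θ) (f s θ) := by
  rw [Model.nested_succ, hM.nested_stationary_succ hγ hst hf]
  unfold Model.discountedStep Model.discount
  simp only [pow_zero]
  rfl

theorem Model.IsWellPosed.abs_discountedStep_sub_le (hM : M.IsWellPosed) (hγ : ∀ θ, 0 < M.γ θ)
    {v v' : S → Θ → ℝ} {s : S} {θ : Θ} {a : A} (ha : a ∈ M.Γ s θ)
    (hv : IsBoundedMeasurable fun s => v s θ) (hv' : IsBoundedMeasurable fun s => v' s θ)
    {C : ℝ} (h : ∀ x, |v x θ - v' x θ| ≤ C) :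
    |M.discountedStep v (s, θ) a - M.discountedStep v' (s, θ) a| ≤ M.γ θ * C := by
  refine hM.abs_stepCost_sub_le ha (hv.const_mul _) (hv'.const_mul _) fun x => ?_
  rw [← mul_sub, abs_mul, abs_of_pos (hγ θ)]
  exact mul_le_mul_of_nonneg_left (h x) (hγ θ).le

theorem Model.IsWellPosed.discountedStep_mono (hM : M.IsWellPosed) (hγ : ∀ θ, 0 < M.γ θ)
    {v v' : S → Θ → ℝ} {s : S} {θ : Θ} {a : A} (ha : a ∈ M.Γ s θ)
    (hv : IsBoundedMeasurable fun s => v s θ) (hv' : IsBoundedMeasurable fun s => v' s θ)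
    (h : ∀ x, v x θ ≤ v' x θ) :
    M.discountedStep v (s, θ) a ≤ M.discountedStep v' (s, θ) a :=
  hM.stepCost_mono ha (hv.const_mul _) (hv'.const_mul _) fun x =>
    mul_le_mul_of_nonneg_left (h x) (hγ θ).le

/-- The nested costs of successive horizons differ by a geometric sequence. -/
theorem Model.IsWellPosed.exists_abs_nested_sub_le (hM : M.IsWellPosed) (hγ : ∀ θ, 0 < M.γ θ)
    (hst : ∀ t, M.stage t = M.stage 0) :
    ∃ C, 0 ≤ C ∧ ∀ π ∈ M.policies, ∀ n t s θ,
      |M.nested M.discount zeroTerminal π (n + 1) t s θ -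
        M.nested M.discount zeroTerminal π n t s θ| ≤ C * M.γ θ ^ (n + t) := by
  obtain ⟨C, hC0, hC⟩ := hM.exists_abs_stepCost_le 0
  refine ⟨C, hC0, fun π hπ n => ?_⟩
  induction n with
  | zero =>
    intro t s θ
    rw [Model.nested_succ, Model.stepCost_eq_of_stationary hst]
    have := hC (M.discount t) zeroTerminal s θ (π t s θ) (hπ.2 t s θ) 0
      (isBoundedContinuous_zeroTerminal.isBoundedMeasurable θ) (by simp [zeroTerminal])
    change |_ - (0 : ℝ)| ≤ _
    rw [sub_zero, zero_add]
    refine this.trans_eq ?_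
    rw [Model.discount, abs_of_pos (pow_pos (hγ θ) t)]
    ring
  | succ n ih =>
    intro t s θ
    rw [Model.nested_succ, Model.nested_succ]
    refine hM.abs_stepCost_sub_le (hπ.2 t s θ)
      (hM.isBoundedMeasurable_nested _ isBoundedContinuous_zeroTerminal hπ _ _ _)
      (hM.isBoundedMeasurable_nested _ isBoundedContinuous_zeroTerminal hπ _ _ _) fun x => ?_
    -- The step itself is only nonexpansive, as the discount sits in the weights; the power of `γ θ`
    -- comes from the later starting time.
    rw [show n + 1 + t = n + (t + 1) by ring]
    exact ih (t + 1) x θ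

end InfiniteHorizon

end RiskMDP

end

/-! ### Infinite horizon: limits, Bellman equation and optimal actions -/

noncomputable section

namespace RiskMDP

variable {d k : ℕ} {S : Set (Fin d → ℝ)} {A : Set (Fin k → ℝ)} {Θ : Type*} {p : ℝ≥0∞}

theorem sInf_image_le_sInf_image_add {B : Type*} [TopologicalSpace B] {K : Set B} {F F' : B → ℝ}
    {C : ℝ} (hK : IsCompact K) (hne : K.Nonempty) (hF : ContinuousOn F K) (hF' : ContinuousOn F' K)
    (h : ∀ a ∈ K, F a ≤ F' a + C) : sInf (F '' K) ≤ sInf (F' '' K) + C := by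
  obtain ⟨a, ha⟩ := nonempty_argminOn hK hne hF'
  rw [sInf_image_eq_of_mem_argminOn ha]
  exact (sInf_image_le_of_isCompact hK hF ha.1).trans (h a ha.1)

theorem abs_sInf_image_sub_le {B : Type*} [TopologicalSpace B] {K : Set B} {F F' : B → ℝ}
    {C : ℝ} (hK : IsCompact K) (hne : K.Nonempty) (hF : ContinuousOn F K) (hF' : ContinuousOn F' K)
    (h : ∀ a ∈ K, |F a - F' a| ≤ C) : |sInf (F '' K) - sInf (F' '' K)| ≤ C := by
  refine abs_le.2 ⟨?_, ?_⟩
  · linarith [sInf_image_le_sInf_image_add hK hne hF' hF fun a ha => by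
      linarith [(abs_le.1 (h a ha)).1]]
  · linarith [sInf_image_le_sInf_image_add hK hne hF hF' fun a ha => by
      linarith [(abs_le.1 (h a ha)).2]]

theorem IsBoundedContinuous.discounted [MetricSpace Θ] [CompactSpace Θ] {M : Model S A Θ p} {v : S → Θ → ℝ}
    (hv : IsBoundedContinuous v) (hγc : Continuous M.γ) :
    IsBoundedContinuous fun s θ => M.γ θ * v s θ := by
  obtain ⟨W, hW⟩ := isCompact_univ.exists_bound_of_continuousOn hγc.continuousOn
  obtain ⟨hc, K, hK⟩ := hv
  refine ⟨(hγc.comp continuous_snd).mul hc, W * K, fun s θ => ?_⟩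
  rw [abs_mul]
  exact mul_le_mul (hW θ (mem_univ θ)) (hK s θ) (abs_nonneg _)
    ((abs_nonneg _).trans (hW θ (mem_univ θ)))

variable [Fact (1 ≤ p)] [MetricSpace Θ] {M : Model S A Θ p}

/-- The increments are dominated by a geometric series of ratio `γbar`, with one constant for all
policies, states and parameters. -/
theorem Model.IsWellPosed.tendsto_nested (hM : M.IsWellPosed) (hγ : ∀ θ, 0 < M.γ θ)
    {γbar : ℝ} (hγ1 : γbar < 1) (hγbar : ∀ θ, M.γ θ ≤ γbar)
    (hst : ∀ t, M.stage t = M.stage 0) :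
    ∃ C, 0 ≤ C ∧ ∀ π ∈ M.policies, ∀ s θ,
      Tendsto (fun N => M.nested M.discount zeroTerminal π N 0 s θ) atTop
        (𝓝 (M.infiniteCost s θ π)) ∧
      ∀ N, |M.nested M.discount zeroTerminal π N 0 s θ - M.infiniteCost s θ π| ≤
        C * γbar ^ N / (1 - γbar) := by
  obtain ⟨C, hC0, hC⟩ := hM.exists_abs_nested_sub_le hγ hst
  refine ⟨C, hC0, fun π hπ s θ => ?_⟩
  have hdist : ∀ N, dist (M.nested M.discount zeroTerminal π N 0 s θ)
      (M.nested M.discount zeroTerminal π (N + 1) 0 s θ) ≤ C * γbar ^ N := fun N => by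
    rw [dist_comm, Real.dist_eq]
    refine (hC π hπ N 0 s θ).trans ?_
    exact mul_le_mul_of_nonneg_left (pow_le_pow_left₀ (hγ θ).le (hγbar θ) N) hC0
  obtain ⟨l, hl⟩ := cauchySeq_tendsto_of_complete (cauchySeq_of_le_geometric _ _ hγ1 hdist)
  have hlim : M.infiniteCost s θ π = l := hl.limUnder_eq
  rw [hlim]
  exact ⟨hl, fun N => dist_le_of_le_geometric_of_tendsto _ _ hγ1 hdist hl N⟩

theorem Model.IsWellPosed.isBoundedMeasurable_infiniteCost (hM : M.IsWellPosed)
    (hγ : ∀ θ, 0 < M.γ θ) {γbar : ℝ} (hγ1 : γbar < 1) (hγbar : ∀ θ, M.γ θ ≤ γbar)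
    (hst : ∀ t, M.stage t = M.stage 0) {π : ℕ → S → Θ → A} (hπ : π ∈ M.policies) (θ : Θ) :
    IsBoundedMeasurable fun s => M.infiniteCost s θ π := by
  obtain ⟨C, hC0, hC⟩ := hM.tendsto_nested hγ hγ1 hγbar hst
  refine ⟨measurable_of_tendsto_metrizable
    (fun N => (hM.isBoundedMeasurable_nested _ isBoundedContinuous_zeroTerminal hπ N 0 θ).1)
    (tendsto_pi_nhds.2 fun s => (hC π hπ s θ).1), C * γbar ^ 0 / (1 - γbar), fun s => ?_⟩
  have := (hC π hπ s θ).2 0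
  rwa [show M.nested M.discount zeroTerminal π 0 0 s θ = 0 from rfl, zero_sub, abs_neg] at this

/-- Bellman equation of a stationary policy. -/
theorem Model.IsWellPosed.infiniteCost_stationary (hM : M.IsWellPosed) (hγ : ∀ θ, 0 < M.γ θ)
    {γbar : ℝ} (hγ1 : γbar < 1) (hγbar : ∀ θ, M.γ θ ≤ γbar)
    (hst : ∀ t, M.stage t = M.stage 0) {f : S → Θ → A} (hf : stationary f ∈ M.policies)
    (s : S) (θ : Θ) : M.infiniteCost s θ (stationary f) =
      M.discountedStep (fun s θ => M.infiniteCost s θ (stationary f)) (s, θ) (f s θ) := by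
  have hγ0 : 0 ≤ γbar := (hγ θ).le.trans (hγbar θ)
  obtain ⟨C, hC0, hC⟩ := hM.tendsto_nested hγ hγ1 hγbar hst
  have h1 := (tendsto_add_atTop_iff_nat 1).2 (hC _ hf s θ).1
  refine tendsto_nhds_unique h1 (tendsto_iff_norm_sub_tendsto_zero.2 ?_)
  have h0 : Tendsto (fun N => M.γ θ * (C * γbar ^ N / (1 - γbar))) atTop (𝓝 0) := by
    have := (((tendsto_pow_atTop_nhds_zero_of_lt_one hγ0 hγ1).const_mul C).div_const
      (1 - γbar)).const_mul (M.γ θ)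
    simpa using this
  refine squeeze_zero (fun _ => norm_nonneg _) (fun N => ?_) h0
  rw [hM.nested_stationary hγ hst hf, Real.norm_eq_abs]
  exact hM.abs_discountedStep_sub_le hγ (hf.2 0 s θ)
    (hM.isBoundedMeasurable_nested _ isBoundedContinuous_zeroTerminal hf N 0 θ)
    (hM.isBoundedMeasurable_infiniteCost hγ hγ1 hγbar hst hf θ) fun x => (hC _ hf x θ).2 N

variable [CompactSpace Θ]

/-- The Bellman equation has a bounded continuous solution, the limit of the value iteration. -/
theorem Model.IsWellPosed.exists_bellman_solution (hM : M.IsWellPosed) (hγ : ∀ θ, 0 < M.γ θ)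
    (hγc : Continuous M.γ) {γbar : ℝ} (hγ1 : γbar < 1) (hγbar : ∀ θ, M.γ θ ≤ γbar)
    (hst : ∀ t, M.stage t = M.stage 0) :
    ∃ V : S → Θ → ℝ, IsBoundedContinuous V ∧
      (∀ s θ, Tendsto (fun N => M.value M.discount zeroTerminal N 0 s θ) atTop (𝓝 (V s θ))) ∧
      ∀ s θ, V s θ = sInf (M.discountedStep V (s, θ) '' M.Γ s θ) := by
  have hw : ∀ t, Continuous (M.discount t) := fun t => hγc.pow t
  have hv := hM.isBoundedContinuous_value hw isBoundedContinuous_zeroTerminal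
  have hcomp : ∀ s θ, IsCompact (M.Γ s θ) := hM.regular.action_compact
  have hne : ∀ s θ, (M.Γ s θ).Nonempty := hM.regular.action_nonempty
  have hsc := fun n t s θ => hM.continuousOn_stepCost_action (hw t) t (hv n (t + 1)) (s, θ)
  -- The positive factor `γ θ` passes through the minimum as it does through the risk, so value
  -- iteration becomes the iteration of `M.discountedStep` followed by minimization.
  have hshift : ∀ n t, M.value M.discount zeroTerminal n (t + 1) =
      fun s θ => M.γ θ * M.value M.discount zeroTerminal n t s θ := by
    intro n
    induction n with
    | zero => intro t; funext s θ; simp [Model.value, zeroTerminal]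
    | succ n ih =>
      intro t
      funext s θ
      rw [Model.value_succ, Model.value_succ, ih (t + 1)]
      obtain ⟨a, ha⟩ := nonempty_argminOn (hcomp s θ) (hne s θ) (hsc n t s θ)
      have heq := fun b (hb : b ∈ M.Γ s θ) => hM.stepCost_discount_succ hγ hst t hb
        ((hv n (t + 1)).isBoundedMeasurable θ)
      rw [sInf_image_eq_of_mem_argminOn ha, ← heq a ha.1]
      refine sInf_image_eq_of_mem_argminOn ⟨ha.1, isMinOn_iff.2 fun b hb => ?_⟩
      rw [heq a ha.1, heq b hb]
      exact mul_le_mul_of_nonneg_left (le_of_mem_argminOn ha hb) (hγ θ).le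
  have hstep : ∀ n s θ, M.value M.discount zeroTerminal (n + 1) 0 s θ =
      sInf (M.discountedStep (M.value M.discount zeroTerminal n 0) (s, θ) '' M.Γ s θ) :=
    fun n s θ => by
      rw [Model.value_succ, hshift]
      unfold Model.discountedStep Model.discount
      simp only [pow_zero]
  have hdc : ∀ {v : S → Θ → ℝ}, IsBoundedContinuous v → ∀ s θ,
      ContinuousOn (M.discountedStep v (s, θ)) (M.Γ s θ) := fun hv s θ =>
    hM.continuousOn_stepCost_action continuous_const 0 (hv.discounted hγc) (s, θ)
  obtain ⟨C, hC0, hC⟩ := hM.exists_abs_stepCost_le 0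
  have hdiff : ∀ n s θ, |M.value M.discount zeroTerminal (n + 1) 0 s θ -
      M.value M.discount zeroTerminal n 0 s θ| ≤ C * M.γ θ ^ n := by
    intro n
    induction n with
    | zero =>
      intro s θ
      rw [Model.value_succ]
      obtain ⟨a, ha⟩ := nonempty_argminOn (hcomp s θ) (hne s θ) (hsc 0 0 s θ)
      rw [sInf_image_eq_of_mem_argminOn ha]
      have := hC (M.discount 0) zeroTerminal s θ a ha.1 0
        (isBoundedContinuous_zeroTerminal.isBoundedMeasurable θ) (by simp [zeroTerminal])
      change |_ - (0 : ℝ)| ≤ _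
      rw [sub_zero]
      refine this.trans_eq ?_
      simp [Model.discount]
    | succ n ih =>
      intro s θ
      rw [hstep (n + 1), hstep n]
      refine abs_sInf_image_sub_le (hcomp s θ) (hne s θ) (hdc (hv _ _) s θ) (hdc (hv _ _) s θ)
        fun a ha => ?_
      rw [pow_succ', mul_left_comm]
      exact hM.abs_discountedStep_sub_le hγ ha ((hv _ _).isBoundedMeasurable θ)
        ((hv _ _).isBoundedMeasurable θ) fun x => ih x θ
  have hdist : ∀ s θ N, dist (M.value M.discount zeroTerminal N 0 s θ)
      (M.value M.discount zeroTerminal (N + 1) 0 s θ) ≤ C * γbar ^ N := fun s θ N => by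
    rw [dist_comm, Real.dist_eq]
    refine (hdiff N s θ).trans ?_
    gcongr
    · exact (hγ θ).le
    · exact hγbar θ
  choose V hV using fun s θ =>
    cauchySeq_tendsto_of_complete (cauchySeq_of_le_geometric _ _ hγ1 (hdist s θ))
  have hbd : ∀ N s θ, |M.value M.discount zeroTerminal N 0 s θ - V s θ| ≤
      C * γbar ^ N / (1 - γbar) := fun N s θ =>
    dist_le_of_le_geometric_of_tendsto _ _ hγ1 (hdist s θ) (hV s θ) N
  have hgeom : 0 ≤ γbar → Tendsto (fun N => C * γbar ^ N / (1 - γbar)) atTop (𝓝 0) := fun hγ0 => by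
    simpa using ((tendsto_pow_atTop_nhds_zero_of_lt_one hγ0 hγ1).const_mul C).div_const (1 - γbar)
  have hVc : IsBoundedContinuous V := by
    refine ⟨?_, C * γbar ^ 0 / (1 - γbar), fun s θ => ?_⟩
    -- `0 ≤ γbar` follows only from the existence of a parameter, so an empty `Θ` is treated apart.
    · rcases isEmpty_or_nonempty Θ with hΘ | ⟨⟨θ₀⟩⟩
      · exact continuous_of_const fun x => isEmptyElim x.2
      · have hγ0 : 0 ≤ γbar := (hγ θ₀).le.trans (hγbar θ₀)
        refine TendstoUniformly.continuous (F := fun N (x : S × Θ) =>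
          M.value M.discount zeroTerminal N 0 x.1 x.2) (p := atTop) ?_
          (Eventually.of_forall fun N => (hv N 0).1).frequently
        refine Metric.tendstoUniformly_iff.2 fun ε hε => ?_
        filter_upwards [(hgeom hγ0).eventually_lt_const hε] with N hN x
        rw [dist_comm]
        exact (hbd N x.1 x.2).trans_lt hN
    · have := hbd 0 s θ
      rwa [show M.value M.discount zeroTerminal 0 0 s θ = 0 from rfl, zero_sub, abs_neg] at this
  refine ⟨V, hVc, hV, fun s θ => ?_⟩
  have hγ0 : 0 ≤ γbar := (hγ θ).le.trans (hγbar θ)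
  refine tendsto_nhds_unique ((tendsto_add_atTop_iff_nat 1).2 (hV s θ))
    (tendsto_iff_norm_sub_tendsto_zero.2 ?_)
  refine squeeze_zero (fun _ => norm_nonneg _) (fun N => ?_)
    (by simpa using (hgeom hγ0).const_mul (M.γ θ))
  rw [hstep, Real.norm_eq_abs]
  exact abs_sInf_image_sub_le (hcomp s θ) (hne s θ) (hdc (hv _ _) s θ) (hdc hVc s θ) fun a ha =>
    hM.abs_discountedStep_sub_le hγ ha ((hv _ _).isBoundedMeasurable θ)
      (hVc.isBoundedMeasurable θ) fun x => hbd N x θ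

theorem Model.IsWellPosed.infinite_horizon (hM : M.IsWellPosed) (hγ : ∀ θ, 0 < M.γ θ)
    (hγc : Continuous M.γ) {γbar : ℝ} (hγ1 : γbar < 1) (hγbar : ∀ θ, M.γ θ ≤ γbar)
    (hst : ∀ t, M.stage t = M.stage 0) :
    (∀ π ∈ M.policies,
        (∀ N t θ, MemLp
          (fun s => M.nested (fun t θ => M.γ θ ^ t) (fun _ _ => 0) π N (t + 1) s θ) p
          ((M.stage t).Q : Measure S)) ∧
        ∀ s θ, Tendsto (fun N => M.truncatedCost N s θ π) atTop (𝓝 (M.infiniteCost s θ π))) ∧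
      (∀ s θ, IsLeast (M.infiniteCost s θ '' M.policies) (M.infiniteValue s θ)) ∧
      (Continuous fun x : S × Θ => M.infiniteValue x.1 x.2) ∧
      (∀ s θ, (M.infiniteOptimalActions s θ).Nonempty ∧
        IsCompact (M.infiniteOptimalActions s θ)) ∧
      (UpperHemicontinuous fun x : S × Θ => M.infiniteOptimalActions x.1 x.2) ∧
      (∀ h : A → ℝ, Continuous h →
        ∃ f : S → Θ → A, RiskMDP.stationary f ∈ M.policies ∧
          (∀ s θ, IsMinOn (M.infiniteCost s θ) M.policies (RiskMDP.stationary f)) ∧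
          (∀ s θ, IsMinOn h (M.infiniteOptimalActions s θ) (f s θ)) ∧
          LowerSemicontinuous fun x : S × Θ => h (f x.1 x.2)) := by
  obtain ⟨C, hC0, hC⟩ := hM.tendsto_nested hγ hγ1 hγbar hst
  obtain ⟨V, hVc, hV, hbell⟩ := hM.exists_bellman_solution hγ hγc hγ1 hγbar hst
  have hw : ∀ t, Continuous (M.discount t) := fun t => hγc.pow t
  have hcont := hVc.discounted (M := M) hγc
  have hle : ∀ π ∈ M.policies, ∀ s θ, V s θ ≤ M.infiniteCost s θ π := fun π hπ s θ =>
    le_of_tendsto_of_tendsto' (hV s θ) (hC π hπ s θ).1 fun N =>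
      hM.value_le_nested hw isBoundedContinuous_zeroTerminal hπ N 0 s θ
  set G : S × Θ → Set A := M.greedy (fun _ => 1) 0 fun s θ => M.γ θ * V s θ with hG
  have hpol : ∀ f : S → Θ → A, (∀ θ, Measurable fun s => f s θ) → (∀ s θ, f s θ ∈ G (s, θ)) →
      stationary f ∈ M.policies := fun f hf hfG =>
    ⟨fun _ θ => hf θ, fun _ s θ => (hfG s θ).1⟩
  -- For a greedy rule, `V` solves the Bellman equation of the policy itself, so the truncated costs
  -- approach `V` at rate `γ θ ^ N`.
  have hopt : ∀ f : S → Θ → A, (∀ θ, Measurable fun s => f s θ) → (∀ s θ, f s θ ∈ G (s, θ)) →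
      ∀ s θ, M.infiniteCost s θ (stationary f) = V s θ := by
    intro f hf hfG s θ
    have hfp := hpol f hf hfG
    obtain ⟨K, hK⟩ := hVc.2
    have hVf : ∀ s, V s θ = M.discountedStep V (s, θ) (f s θ) := fun s =>
      (hbell s θ).trans (sInf_image_eq_of_mem_argminOn (hfG s θ))
    have hdiff : ∀ N s, |M.nested M.discount zeroTerminal (stationary f) N 0 s θ - V s θ| ≤
        M.γ θ ^ N * K := by
      intro N
      induction N with
      | zero =>
        intro s
        rw [show M.nested M.discount zeroTerminal (stationary f) 0 0 s θ = 0 from rfl, zero_sub,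
          abs_neg, pow_zero, one_mul]
        exact hK s θ
      | succ N ih =>
        intro s
        rw [hM.nested_stationary hγ hst hfp, hVf s, pow_succ', mul_assoc]
        exact hM.abs_discountedStep_sub_le hγ (hfG s θ).1
          (hM.isBoundedMeasurable_nested _ isBoundedContinuous_zeroTerminal hfp N 0 θ)
          (hVc.isBoundedMeasurable θ) ih
    refine tendsto_nhds_unique (hC _ hfp s θ).1 (tendsto_iff_norm_sub_tendsto_zero.2 ?_)
    refine squeeze_zero (fun _ => norm_nonneg _) (fun N => hdiff N s) ?_
    simpa using (tendsto_pow_atTop_nhds_zero_of_lt_one (hγ θ).le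
      ((hγbar θ).trans_lt hγ1)).mul_const K
  have hmin : ∀ f : S → Θ → A, (∀ θ, Measurable fun s => f s θ) → (∀ s θ, f s θ ∈ G (s, θ)) →
      ∀ s θ, IsMinOn (M.infiniteCost s θ) M.policies (stationary f) := fun f hf hfG s θ =>
    isMinOn_iff.2 fun π hπ => (hopt f hf hfG s θ).trans_le (hle π hπ s θ)
  have hsel := fun (h : A → ℝ) (hh : Continuous h) => exists_selection
    (hM.upperHemicontinuous_greedy (w := fun _ => 1) continuous_const 0 hcont)
    (hM.nonempty_argminOn_stepCost continuous_const 0 hcont)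
    (hM.isCompact_greedy continuous_const 0 hcont) hh
  obtain ⟨g, hgm, hgG, -⟩ := hsel (fun _ => 0) continuous_const
  have hgG' := fun s θ => (hgG s θ).1
  have hleast : ∀ s θ, IsLeast (M.infiniteCost s θ '' M.policies) (V s θ) := fun s θ =>
    ⟨⟨_, hpol g hgm hgG', hopt g hgm hgG' s θ⟩, by rintro _ ⟨π, hπ, rfl⟩; exact hle π hπ s θ⟩
  have hval : ∀ s θ, M.infiniteValue s θ = V s θ := fun s θ => (hleast s θ).csInf_eq
  -- Optimality is assumed at the single start `(s, θ)`. This suffices: `V` bounds the cost of the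
  -- policy from below at every next state, so the Bellman cost of `f s θ` with continuation `V` is
  -- at most the cost of the policy, which is `V s θ`. Conversely, the greedy rule `g` is changed at
  -- one point.
  have hact : ∀ s θ, M.infiniteOptimalActions s θ = G (s, θ) := by
    intro s θ
    ext a
    constructor
    · rintro ⟨f, hf, rfl, hfmin⟩
      refine mem_argminOn_of_le (hM.regular.action_compact _ _)
        (hM.continuousOn_stepCost_action continuous_const 0 hcont (s, θ)) (hf.2 0 s θ) ?_
      calc M.discountedStep V (s, θ) (f s θ)
          ≤ M.discountedStep (fun s θ => M.infiniteCost s θ (stationary f)) (s, θ) (f s θ) :=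
            hM.discountedStep_mono hγ (hf.2 0 s θ) (hVc.isBoundedMeasurable θ)
              (hM.isBoundedMeasurable_infiniteCost hγ hγ1 hγbar hst hf θ) fun x => hle _ hf x θ
        _ = M.infiniteCost s θ (stationary f) :=
            (hM.infiniteCost_stationary hγ hγ1 hγbar hst hf s θ).symm
        _ ≤ M.infiniteCost s θ (stationary g) := isMinOn_iff.1 hfmin _ (hpol g hgm hgG')
        _ = V s θ := hopt g hgm hgG' s θ
        _ = _ := hbell s θ
    · intro ha
      have h1 := measurable_modifyAt hgm s θ a
      have h2 := modifyAt_mem hgG' ha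
      exact ⟨modifyAt g s θ a, hpol _ h1 h2, modifyAt_self g s θ a, hmin _ h1 h2 s θ⟩
  refine ⟨fun π hπ => ⟨fun N t θ => ?_, fun s θ => (hC π hπ s θ).1⟩, fun s θ => ?_, ?_,
    fun s θ => ?_, ?_, fun h hh => ?_⟩
  · exact (hM.isBoundedMeasurable_nested M.discount isBoundedContinuous_zeroTerminal hπ N (t + 1)
      θ).memLp p _
  · rw [hval]
    exact hleast s θ
  · simp only [hval]
    exact hVc.1
  · rw [hact]
    exact ⟨hM.nonempty_argminOn_stepCost continuous_const 0 hcont (s, θ),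
      hM.isCompact_greedy continuous_const 0 hcont (s, θ)⟩
  · simp only [hact]
    exact hM.upperHemicontinuous_greedy continuous_const 0 hcont
  · obtain ⟨f, hfm, hfG, hfl⟩ := hsel h hh
    have hfG' := fun s θ => (hfG s θ).1
    refine ⟨f, hpol f hfm hfG', hmin f hfm hfG', fun s θ => ?_, hfl⟩
    rw [hact]
    exact (hfG s θ).2

end RiskMDP

end

theorem mainTheorem2 {d k : ℕ} {S : Set (Fin d → ℝ)} {A : Set (Fin k → ℝ)}
    (hS : MeasurableSet S) (hA : MeasurableSet A) (hSord : RiskMDP.OrderNeighbourhoods S)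
    {Θ : Type*} [MetricSpace Θ] [CompactSpace Θ]
    {p : ℝ≥0∞} [Fact (1 ≤ p)] (hp1 : 1 < p) (hp : p < ⊤)
    (M : RiskMDP.Model S A Θ p)
    (hreg : M.IsRegular) (hmono : M.IsMonotone) (hcont : M.IsSepContinuous)
    (hrisk : ∀ t, (M.stage t).IsMarkovCoherent M.Γ)
    (henv : ∀ t, (M.stage t).EnvelopeContinuous M.Γ) :
    -- finite horizon
    (∀ T : ℕ,
      -- the costs-to-go evaluated by the one-step risk measures are in their domains
      (∀ π ∈ M.policies, ∀ t < T, ∀ θ,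
        MemLp (fun s => M.finiteCost T (t + 1) s θ π) p ((M.stage t).Q : Measure S)) ∧
      -- minima are attained and the value functions are jointly continuous
      (∀ t ≤ T,
        (∀ s θ, IsLeast (M.finiteCost T t s θ '' M.policies) (M.finiteValue T t s θ)) ∧
        Continuous fun x : S × Θ => M.finiteValue T t x.1 x.2) ∧
      -- the optimal actions form an upper hemicontinuous correspondence
      (∀ t < T,
        (∀ s θ, (M.finiteOptimalActions T t s θ).Nonempty ∧
          IsCompact (M.finiteOptimalActions T t s θ)) ∧
        UpperHemicontinuous fun x : S × Θ => M.finiteOptimalActions T t x.1 x.2) ∧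
      -- lower semicontinuous optimal policies
      (∀ h : ℕ → A → ℝ, (∀ t, Continuous (h t)) →
        ∃ π ∈ M.policies,
          (∀ t ≤ T, ∀ s θ, IsMinOn (M.finiteCost T t s θ) M.policies π) ∧
          ∀ t < T, (∀ s θ, IsMinOn (h t) (M.finiteOptimalActions T t s θ) (π t s θ)) ∧
            LowerSemicontinuous fun x : S × Θ => h t (π t x.1 x.2))) ∧
    -- infinite horizon, stationary case
    ((∀ t, M.stage t = M.stage 0) →
      -- the objective is well defined
      (∀ π ∈ M.policies,
        (∀ N t θ, MemLp
          (fun s => M.nested (fun t θ => M.γ θ ^ t) (fun _ _ => 0) π N (t + 1) s θ) p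
          ((M.stage t).Q : Measure S)) ∧
        ∀ s θ, Tendsto (fun N => M.truncatedCost N s θ π) atTop (𝓝 (M.infiniteCost s θ π))) ∧
      -- minima are attained and the value function is jointly continuous
      (∀ s θ, IsLeast (M.infiniteCost s θ '' M.policies) (M.infiniteValue s θ)) ∧
      (Continuous fun x : S × Θ => M.infiniteValue x.1 x.2) ∧
      -- the optimal actions form an upper hemicontinuous correspondence
      (∀ s θ, (M.infiniteOptimalActions s θ).Nonempty ∧
        IsCompact (M.infiniteOptimalActions s θ)) ∧
      (UpperHemicontinuous fun x : S × Θ => M.infiniteOptimalActions x.1 x.2) ∧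
      -- lower semicontinuous optimal stationary policies
      (∀ h : A → ℝ, Continuous h →
        ∃ f : S → Θ → A, RiskMDP.stationary f ∈ M.policies ∧
          (∀ s θ, IsMinOn (M.infiniteCost s θ) M.policies (RiskMDP.stationary f)) ∧
          (∀ s θ, IsMinOn h (M.infiniteOptimalActions s θ) (f s θ)) ∧
          LowerSemicontinuous fun x : S × Θ => h (f x.1 x.2))) := by
  have hM : M.IsWellPosed :=
    { ne_top := hp.ne
      regular := hreg
      kernel := RiskMDP.Model.continuous_kernel hSord hmono hcont
      cost := RiskMDP.Model.continuous_cost hSord hmono hcont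
      upper := RiskMDP.Model.upperHemicontinuous_action hSord hmono hcont
      lower := RiskMDP.Model.lowerHemicontinuous_action hSord hmono hcont
      coherent := hrisk
      envelope := henv }
  obtain ⟨hγc, γbar, hγ1, hγ⟩ := hcont.discount
  obtain ⟨C, hC⟩ := hreg.terminal
  have hterm : RiskMDP.IsBoundedContinuous M.cT :=
    ⟨RiskMDP.Model.continuous_terminal hSord hmono hcont, C, fun s θ => by
      rw [abs_of_nonneg (hC s θ).1]
      exact (hC s θ).2⟩
  exact ⟨hM.finite_horizon hterm,
    hM.infinite_horizon (fun θ => (hγ θ).1) hγc hγ1 fun θ => (hγ θ).2⟩
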